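/- Setting. Let $\mathcal D=C_0^\infty(\mathbb R^2)$ (real-valued), let $\mathcal D'$ be its dual, the space of distributions on $\mathbb R^2$, with the cylinder $\sigma$-algebra, and let $\sigma$ be a positive measure on $(0,\infty)$ with $\int_0^\infty\tau^2\,\sigma(d\tau)<\infty$. Let $\nu$ be the centered Lévy noise measure with Lévy measure $\sigma$, i.e. the probability measure on $\mathcal D'$ with $$\int_{\mathcal D'}e^{i\langle\omega,\varphi\rangle}\,\nu(d\omega)=\exp\Big[\int_{\mathbb R^2}\int_{(0,\infty)}\big(e^{i\tau\varphi(x,y)}-1-i\tau\varphi(x,y)\big)\,\sigma(d\tau)\,dx\,dy\Big],\qquad\varphi\in\mathcal D.$$ For $f\in L^2(\mathbb R^2,dx\,dy)$ let $\langle\cdot,f\rangle\in L^2(\nu)$ denote the value at $f$ of the extension by continuity of the map $\mathcal D\to L^2(\nu)$, $\varphi\mapsto\langle\cdot,\varphi\rangle$. Let $\varkappa:[0,\infty)^2\to[0,\infty)$ be measurable and locally bounded, and for $s,t\ge0$ let $$X_{s,t}=\langle\omega(x,y),\mathbf 1_{[0,s]}(x)\mathbf 1_{[0,t]}(y)\varkappa(x,y)\rangle,$$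 where the versions of these random variables are chosen so that $(s,t,\omega)\mapsto X_{s,t}(\omega)$ is jointly measurable. Let $\mu_{s,t}$ be a deterministic real function that is continuous on $\{(s,t):0\le s\le t\}$. For $0\le s\le t$ put $$F_{s,t}=\mu_{s,t}+X_{s,t},\quad R_s=F_{s,s},\quad P_{s,t}=\exp\Big[-\int_s^tF_{s,u}\,du\Big],\quad Z_{s,t}=P_{s,t}\exp\Big[-\int_0^sR_u\,du\Big],$$ and let $\mathcal F_s$ be the $\sigma$-algebra generated by the random variables $F_{u,v}$, $0\le u\le s$, $u\le v$ (which are defined up to $\nu$-null sets, so that $\mathcal F_s$ contains the measurable $\nu$-null sets). Theorem. The following three statements are equivalent. (a) For each $t\ge0$, the discounted bond-price process $(Z_{s,t},\mathcal F_s)_{0\le s\le t}$ is a martingale under $\nu$. (b) For all $0\le s\le t$, $$\mu_{s,t}=\mu_{0,t}+\int_0^t\int_0^s\int_{(0,\infty)}\tau\varkappa(x,y)\big(1-e^{-\tau\varkappa(x,y)(t-(x\vee y))}\big)\,\sigma(d\tau)\,dx\,dy.$$ (c) For all $0\le s\le t$, $P_{s,t}=\mathbb E\big(e^{-\int_s^tR_u\,du}\mid\mathcal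 F_s\big)$ $\nu$-almost surely. -/

import Mathlib

open MeasureTheory ProbabilityTheory Set Filter
open scoped Topology Distributions

noncomputable section

namespace LevyTermStructure

/-- The space `𝒟 = C₀^∞(ℝ²)` of real test functions, with its usual inductive limit topology. -/
abbrev TestFn : Type := 𝓓((⊤ : TopologicalSpace.Opens (ℝ × ℝ)), ℝ)

/-- The space `𝒟'` of real distributions on `ℝ²`. -/
abbrev Dist : Type := 𝓓'((⊤ : TopologicalSpace.Opens (ℝ × ℝ)), ℝ)

/-- The cylinder σ-algebra on `𝒟'`: the smallest one making every `ω ↦ ⟨ω, φ⟩` measurable. -/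
instance cylinder : MeasurableSpace Dist :=
  ⨆ φ : TestFn, (borel ℝ).comap fun ω : Dist => ω φ

/-- `ν` has the Fourier transform of the centered Lévy noise with Lévy measure `σ` on `(0, ∞)`.
(A measure on `(0, ∞)` is given as a measure on `ℝ` of which only the restriction to `(0, ∞)` is
ever used.) -/
def IsCenteredLevyNoise (σ : Measure ℝ) (ν : Measure Dist) : Prop :=
  ∀ φ : TestFn,
    ∫ ω : Dist, Complex.exp (Complex.I * ((ω φ : ℝ) : ℂ)) ∂ν =
      Complex.exp (∫ p : ℝ × ℝ, ∫ τ in Ioi (0 : ℝ),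
        (Complex.exp (Complex.I * ((τ * φ p : ℝ) : ℂ)) - 1 - Complex.I * ((τ * φ p : ℝ) : ℂ)) ∂σ)

/-- `Y` is a version of the random variable `⟨·, f⟩`, `f ∈ L²(ℝ², dx dy)`: the value at `f` of the
extension by continuity of `𝒟 → L²(ν)`, `φ ↦ ⟨·, φ⟩`. That is, `(f, Y)` lies in the closure in
`L²(dx dy) × L²(ν)` of the graph of that map. -/
def IsPairing (ν : Measure Dist) (f : ℝ × ℝ → ℝ) (Y : Dist → ℝ) : Prop :=
  MemLp f 2 volume ∧ MemLp Y 2 ν ∧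
  ∃ φ : ℕ → TestFn,
    Tendsto (fun n => eLpNorm (fun p => φ n p - f p) 2 volume) atTop (𝓝 0) ∧
    Tendsto (fun n => eLpNorm (fun ω : Dist => ω (φ n) - Y ω) 2 ν) atTop (𝓝 0)

/-- `X` is a jointly measurable version of the Lévy field
`X_{s,t} = ⟨ω(x,y), 1_{[0,s]}(x) 1_{[0,t]}(y) ϰ(x,y)⟩`, `s, t ≥ 0`. Each `X_{s,t}` is determined
up to a `ν`-null set only; joint measurability gives sense to the integrals `∫ X_{s,u}(ω) du`. -/
structure IsLevyField (ν : Measure Dist) (ϰ : ℝ × ℝ → ℝ) (X : ℝ → ℝ → Dist → ℝ) : Prop where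
  measurable : Measurable fun q : ℝ × ℝ × Dist => X q.1 q.2.1 q.2.2
  isPairing : ∀ s t : ℝ, 0 ≤ s → 0 ≤ t →
    IsPairing ν ((Icc 0 s ×ˢ Icc 0 t).indicator ϰ) (X s t)

/-- The forward rate `F_{s,t} = μ_{s,t} + X_{s,t}` (for `0 ≤ s ≤ t`). -/
def forwardRate (μ : ℝ → ℝ → ℝ) (X : ℝ → ℝ → Dist → ℝ) (s t : ℝ) (ω : Dist) : ℝ :=
  μ s t + X s t ω

/-- The spot rate `R_s = F_{s,s}`. -/
def spotRate (F : ℝ → ℝ → Dist → ℝ) (s : ℝ) (ω : Dist) : ℝ := F s s ω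

/-- The bond price `P_{s,t} = exp (-∫_s^t F_{s,u} du)`. -/
def bondPrice (F : ℝ → ℝ → Dist → ℝ) (s t : ℝ) (ω : Dist) : ℝ :=
  Real.exp (-∫ u in s..t, F s u ω)

/-- The discounted bond price `Z_{s,t} = P_{s,t} exp (-∫_0^s R_u du)`. -/
def discountedBondPrice (F : ℝ → ℝ → Dist → ℝ) (s t : ℝ) (ω : Dist) : ℝ :=
  bondPrice F s t ω * Real.exp (-∫ u in (0 : ℝ)..s, spotRate F u ω)

/-- The σ-algebra generated by the random variables `F_{u,v}`, `0 ≤ u ≤ s`, `u ≤ v`. -/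
@[reducible] def rawInfo (F : ℝ → ℝ → Dist → ℝ) (s : ℝ) : MeasurableSpace Dist :=
  ⨆ u ∈ Icc 0 s, ⨆ v ∈ Ici u, (borel ℝ).comap (F u v)

/-- `ℱ_s`: the σ-algebra generated by the random variables `F_{u,v}`, `0 ≤ u ≤ s`, `u ≤ v`. These
being defined up to `ν`-null sets, it consists of the events that are `ν`-a.e. equal to a set of
the σ-algebra generated by given versions. -/
@[reducible] def info (ν : Measure Dist) (F : ℝ → ℝ → Dist → ℝ) (s : ℝ) : MeasurableSpace Dist :=
  eventuallyMeasurableSpace (rawInfo F s) (ae ν) ⊓ cylinder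

lemma info_le (ν : Measure Dist) (F : ℝ → ℝ → Dist → ℝ) (s : ℝ) : info ν F s ≤ cylinder :=
  inf_le_right

lemma rawInfo_mono (F : ℝ → ℝ → Dist → ℝ) {s s' : ℝ} (h : s ≤ s') :
    rawInfo F s ≤ rawInfo F s' :=
  biSup_mono fun _ hu => ⟨hu.1, hu.2.trans h⟩

lemma info_mono (ν : Measure Dist) (F : ℝ → ℝ → Dist → ℝ) {s s' : ℝ} (h : s ≤ s') :
    info ν F s ≤ info ν F s' := by
  refine inf_le_inf ?_ le_rfl
  rintro A ⟨B, hB, hAB⟩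
  exact ⟨B, rawInfo_mono F h B hB, hAB⟩

/-- The filtration `(ℱ_s)`, `0 ≤ s ≤ t`. -/
def infoFiltration (ν : Measure Dist) (F : ℝ → ℝ → Dist → ℝ) (t : ℝ) :
    Filtration (Icc (0 : ℝ) t) cylinder where
  seq s := info ν F s
  mono' _ _ h := info_mono ν F h
  le' s := info_le ν F s

end LevyTermStructure

end

/-!
The noise `ω` is a centered infinitely divisible random measure whose jumps have the intensity
`dx dy σ(dτ)`. Its extension to `L²` is handled as a closed graph (`Pairs`): passing to the limit in
the characteristic functional gives, for every `f ∈ L²`, the exponent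
`∫ (e^{iτf} - 1 - iτf) σ(dτ) dx dy` of `⟨ω, f⟩` (`Pairs.charFun`). Everything else about the noise
is read off from this formula.

* It bounds `‖⟨·, f⟩‖₂` by a multiple of `‖f‖₂` (`Pairs.toReal_eLpNorm_sq_le`), so that pairings may
  be integrated over a parameter inside the closed graph (`Pairs.intervalIntegral`).
* Exponents of functions with disjoint supports add up, hence values at such functions are
  independent (`indepFun_of_pairs`).
* For `f ≥ 0` the exponent continues to the upper half-plane. The Gaussian regularizations of
  `E e^{-⟨ω, f⟩}` are Fourier integrals of the characteristic function, and shifting their contour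
  to `Im z = 1` gives `E e^{-⟨ω, f⟩} = exp ∫ (e^{-τf} - 1 + τf) σ(dτ) dx dy`
  (`integral_exp_neg_of_charFun`).

Integrating the field shows `-log Z_{s,t} = m(s,t) + ⟨ω, g_s⟩`, with the deterministic
`m(s,t) = ∫_s^t μ_{s,u} du + ∫_0^s μ_{u,u} du` and the kernel
`g_s(x,y) = 1_{x ≤ s} ϰ(x,y) (t - x ∨ y)⁺` (`IsModel.pairs_randomExponent`). The increments of
`⟨ω, g_s⟩` evaluate the noise on strips `s < x ≤ s'` and are therefore independent of `ℱ_s`; so `Z`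
is a martingale if and only if `E Z_{s,t}` does not depend on `s` (`IsModel.martingale_iff`), that
is, `m(s,t) - m(0,t) = ∫ (e^{-τ g_s} - 1 + τ g_s) σ(dτ) dx dy`. The right-hand side is
`∫_s^t B(s,u) du + ∫_0^s B(u,u) du` with the drift correction `B` (`driftCorrection`), because
`e^{-az} - 1 + az` at `z = (t - x ∨ y)⁺` has the time derivative `a (1 - e^{-az})`. Hence the drift
condition `μ_{s,t} = μ_{0,t} + B(s,t)` integrates to this identity, and differentiating the identity
in `t` gives the drift condition back (`IsModel.drift_condition_iff`).

Finally `Z_{t,t} = e^{-∫_0^s R} e^{-∫_s^t R}` with an `ℱ_s`-measurable first factor, so the formula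
`P_{s,t} = E(e^{-∫_s^t R} | ℱ_s)` says `Z_{s,t} = E(Z_{t,t} | ℱ_s)`
(`IsModel.bondPrice_ae_eq_iff`).
-/

open MeasureTheory ProbabilityTheory Set Filter
open scoped Topology Distributions

noncomputable section

namespace LevyTermStructure

/-! ### Compensated exponentials and Lévy exponents -/

/-- The compensated exponential `e^{iz} - 1 - iz`. -/
def compExp (z : ℂ) : ℂ := Complex.exp (Complex.I * z) - 1 - Complex.I * z

lemma compExp_zero : compExp 0 = 0 := by simp [compExp]

lemma differentiable_compExp : Differentiable ℂ compExp := by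
  unfold compExp; fun_prop

lemma continuous_compExp : Continuous compExp := differentiable_compExp.continuous

lemma hasDerivAt_compExp (z : ℂ) :
    HasDerivAt compExp (Complex.I * (Complex.exp (Complex.I * z) - 1)) z := by
  have h1 : HasDerivAt (fun z : ℂ => Complex.I * z) Complex.I z := by
    simpa using (hasDerivAt_id z).const_mul Complex.I
  have := (h1.cexp.sub_const 1).sub h1
  refine this.congr_deriv ?_
  ring

lemma norm_exp_I_mul_le_one {z : ℂ} (hz : 0 ≤ z.im) : ‖Complex.exp (Complex.I * z)‖ ≤ 1 := by
  rw [Complex.norm_exp, Complex.I_mul_re, Real.exp_le_one_iff]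
  linarith

lemma convex_upperHalf : Convex ℝ {z : ℂ | 0 ≤ z.im} := convex_halfSpace_im_ge 0

lemma norm_exp_I_mul_sub_exp_I_mul_le {z w : ℂ} (hz : 0 ≤ z.im) (hw : 0 ≤ w.im) :
    ‖Complex.exp (Complex.I * z) - Complex.exp (Complex.I * w)‖ ≤ ‖z - w‖ := by
  have h := convex_upperHalf.norm_image_sub_le_of_norm_hasDerivWithin_le (𝕜 := ℂ) (C := 1)
    (f := fun z : ℂ => Complex.exp (Complex.I * z))
    (f' := fun z : ℂ => Complex.exp (Complex.I * z) * Complex.I)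
    (fun x _ => by
      have h1 : HasDerivAt (fun z : ℂ => Complex.I * z) Complex.I x := by
        simpa using (hasDerivAt_id x).const_mul Complex.I
      exact h1.cexp.hasDerivWithinAt)
    (fun x hx => by simpa using norm_exp_I_mul_le_one hx) hw hz
  simpa using h

lemma norm_exp_I_mul_sub_one_le {z : ℂ} (hz : 0 ≤ z.im) :
    ‖Complex.exp (Complex.I * z) - 1‖ ≤ ‖z‖ := by
  simpa using norm_exp_I_mul_sub_exp_I_mul_le hz (w := 0) (by simp)

lemma norm_compExp_sub_le {z w : ℂ} (hz : 0 ≤ z.im) (hw : 0 ≤ w.im) :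
    ‖compExp z - compExp w‖ ≤ (‖z‖ + ‖w‖) * ‖z - w‖ := by
  have hconv : Convex ℝ ({z : ℂ | 0 ≤ z.im} ∩ Metric.closedBall 0 (‖z‖ + ‖w‖)) :=
    convex_upperHalf.inter (convex_closedBall _ _)
  refine hconv.norm_image_sub_le_of_norm_hasDerivWithin_le (𝕜 := ℂ)
    (fun x _ => (hasDerivAt_compExp x).hasDerivWithinAt) (fun x hx => ?_) ⟨hw, ?_⟩ ⟨hz, ?_⟩
  · rw [norm_mul, Complex.norm_I, one_mul]
    exact (norm_exp_I_mul_sub_one_le hx.1).trans (by simpa using hx.2)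
  · simp
  · simp

lemma norm_compExp_le {z : ℂ} (hz : 0 ≤ z.im) : ‖compExp z‖ ≤ ‖z‖ ^ 2 := by
  simpa [compExp_zero, sq] using norm_compExp_sub_le hz (w := 0) (by simp)

section Exponent

variable {β : Type*} [MeasurableSpace β] {M : Measure β} {G H : β → ℝ}

/-- The Lévy exponent `∫ (e^{izG} - 1 - izG) dM` of a jump-size function `G`, as a function of the
complex frequency `z`. -/
def levyExponent (M : Measure β) (G : β → ℝ) (z : ℂ) : ℂ := ∫ q, compExp (z * (G q : ℂ)) ∂M

lemma im_mul_ofReal_nonneg {z : ℂ} {a : ℝ} (h : 0 ≤ z.im * a) : 0 ≤ (z * (a : ℂ)).im := by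
  simpa using h

lemma aestronglyMeasurable_compExp_mul (hG : AEStronglyMeasurable G M) (z : ℂ) :
    AEStronglyMeasurable (fun q => compExp (z * (G q : ℂ))) M := by
  refine continuous_compExp.comp_aestronglyMeasurable ?_
  exact (Complex.continuous_ofReal.comp_aestronglyMeasurable hG).const_mul z

lemma integrable_compExp (hG : MemLp G 2 M) {z : ℂ} (hz : ∀ᵐ q ∂M, 0 ≤ z.im * G q) :
    Integrable (fun q => compExp (z * (G q : ℂ))) M := by
  refine Integrable.mono' (hG.integrable_sq.const_mul (‖z‖ ^ 2))
    (aestronglyMeasurable_compExp_mul hG.1 z) ?_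
  filter_upwards [hz] with q hq
  refine (norm_compExp_le (im_mul_ofReal_nonneg hq)).trans (le_of_eq ?_)
  rw [norm_mul, mul_pow, Complex.norm_real, Real.norm_eq_abs, sq_abs]

lemma norm_levyExponent_le (hG : MemLp G 2 M) {z : ℂ} (hz : ∀ᵐ q ∂M, 0 ≤ z.im * G q) :
    ‖levyExponent M G z‖ ≤ ‖z‖ ^ 2 * ∫ q, G q ^ 2 ∂M := by
  rw [← integral_const_mul]
  refine norm_integral_le_of_norm_le (hG.integrable_sq.const_mul (‖z‖ ^ 2)) ?_
  filter_upwards [hz] with q hq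
  refine (norm_compExp_le (im_mul_ofReal_nonneg hq)).trans (le_of_eq ?_)
  rw [norm_mul, mul_pow, Complex.norm_real, Real.norm_eq_abs, sq_abs]

/-- Jump functions with disjoint supports have additive exponents. -/
lemma levyExponent_add_of_mul_eq_zero (hG : MemLp G 2 M) (hH : MemLp H 2 M)
    (hGH : ∀ᵐ q ∂M, G q * H q = 0) :
    levyExponent M (fun q => G q + H q) 1 = levyExponent M G 1 + levyExponent M H 1 := by
  unfold levyExponent
  rw [← integral_add (integrable_compExp hG (by simp)) (integrable_compExp hH (by simp))]
  refine integral_congr_ae ?_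
  filter_upwards [hGH] with q hq
  rcases mul_eq_zero.1 hq with h | h <;> simp [h, compExp_zero]

lemma norm_levyExponent_sub_le (hG : MemLp G 2 M) (hH : MemLp H 2 M) :
    ‖levyExponent M G 1 - levyExponent M H 1‖ ≤
      ((eLpNorm G 2 M).toReal + (eLpNorm H 2 M).toReal) *
        (eLpNorm (fun q => G q - H q) 2 M).toReal := by
  have hsub : MemLp (fun q => G q - H q) 2 M := hG.sub hH
  have h1 : Integrable (fun q => |G q| * |G q - H q|) M := hG.abs.integrable_mul hsub.abs
  have h2 : Integrable (fun q => |H q| * |G q - H q|) M := hH.abs.integrable_mul hsub.abs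
  have key : ∀ {A B : β → ℝ}, MemLp A 2 M → MemLp B 2 M →
      ∫ q, |A q| * |B q| ∂M ≤ (eLpNorm A 2 M).toReal * (eLpNorm B 2 M).toReal := by
    intro A B hA hB
    rw [← ENNReal.toReal_mul]
    have hmul : MemLp (fun q => A q * B q) 1 M := hB.mul' (r := 1) hA
    have := eLpNorm_smul_le_mul_eLpNorm (p := 2) (q := 2) (r := 1) hB.1 hA.1
    calc ∫ q, |A q| * |B q| ∂M = ∫ q, ‖A q * B q‖ ∂M := by simp
      _ = (eLpNorm (fun q => A q * B q) 1 M).toReal := by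
          rw [integral_norm_eq_lintegral_enorm hmul.1, eLpNorm_one_eq_lintegral_enorm]
      _ ≤ _ := ENNReal.toReal_mono (ENNReal.mul_ne_top hA.2.ne hB.2.ne) this
  unfold levyExponent
  rw [← integral_sub (integrable_compExp hG (by simp)) (integrable_compExp hH (by simp)), add_mul]
  refine (norm_integral_le_of_norm_le (h1.add h2) ?_).trans ?_
  · refine Eventually.of_forall fun q => ?_
    refine (norm_compExp_sub_le (by simp) (by simp)).trans (le_of_eq ?_)
    simp only [one_mul, Complex.norm_real, Real.norm_eq_abs, ← Complex.ofReal_sub, Pi.add_apply]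
    ring
  · rw [integral_add' h1 h2]
    exact add_le_add (key hG hsub) (key hH hsub)

/-- At the frequency `i` the exponent is the real integral `∫ (e^{-G} - 1 + G) dM`. -/
lemma levyExponent_I : levyExponent M G Complex.I =
    ((∫ q, (Real.exp (-G q) - 1 + G q) ∂M : ℝ) : ℂ) := by
  unfold levyExponent
  rw [← integral_complex_ofReal]
  congr 1
  ext q
  have : Complex.I * (Complex.I * (G q : ℂ)) = -(G q : ℂ) := by
    rw [← mul_assoc, Complex.I_mul_I, neg_one_mul]
  unfold compExp
  rw [this]
  push_cast
  ring

/-- On horizontal lines of the upper half-plane the real part of the exponent of a nonnegative jump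
function is bounded above, uniformly in the real part of the frequency. -/
lemma re_levyExponent_le (hG : MemLp G 2 M) (hG0 : ∀ᵐ q ∂M, 0 ≤ G q) {z : ℂ} (hz : 0 ≤ z.im) :
    (levyExponent M G z).re ≤ z.im ^ 2 * ∫ q, G q ^ 2 ∂M := by
  have hint := integrable_compExp hG (z := z)
    (by filter_upwards [hG0] with q hq using mul_nonneg hz hq)
  unfold levyExponent
  have hre : (∫ q, compExp (z * (G q : ℂ)) ∂M).re = ∫ q, (compExp (z * (G q : ℂ))).re ∂M :=
    (integral_re hint).symm
  rw [hre, ← integral_const_mul]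
  refine integral_mono_ae hint.re (hG.integrable_sq.const_mul _) ?_
  filter_upwards [hG0] with q hq
  have h1 : (compExp (z * (G q : ℂ))).re ≤
      Real.exp (-(z.im * G q)) - 1 + z.im * G q := by
    simp only [compExp, Complex.sub_re, Complex.exp_re, Complex.one_re, Complex.I_mul_re,
      Complex.mul_im, Complex.I_re, Complex.I_im, Complex.ofReal_re, Complex.ofReal_im, mul_zero,
      zero_mul, one_mul, zero_add]
    have := mul_le_mul_of_nonneg_left (Real.cos_le_one ((z * (G q : ℂ)).re))
      (Real.exp_pos (-(z.im * G q))).le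
    linarith
  have h2 : Real.exp (-(z.im * G q)) - 1 + z.im * G q ≤ (z.im * G q) ^ 2 := by
    have h0 : 0 ≤ (Complex.I * ((z.im * G q : ℝ) : ℂ)).im := by
      simpa using mul_nonneg hz hq
    have := (Complex.re_le_norm _).trans (norm_compExp_le h0)
    have e : Complex.I * (Complex.I * ((z.im * G q : ℝ) : ℂ)) = ((-(z.im * G q) : ℝ) : ℂ) := by
      rw [← mul_assoc, Complex.I_mul_I]; push_cast; ring
    rw [compExp, e, ← Complex.ofReal_exp, ← Complex.ofReal_one, ← Complex.ofReal_sub,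
      ← Complex.ofReal_sub, Complex.ofReal_re, norm_mul, Complex.norm_I, one_mul,
      Complex.norm_real, Real.norm_eq_abs, sq_abs] at this
    linarith
  exact (h1.trans h2).trans (by rw [mul_pow])

lemma continuousOn_levyExponent (hG : MemLp G 2 M) (hG0 : ∀ᵐ q ∂M, 0 ≤ G q) :
    ContinuousOn (levyExponent M G) {z | 0 ≤ z.im} := by
  intro z₀ hz₀
  unfold levyExponent ContinuousWithinAt
  refine tendsto_integral_filter_of_dominated_convergence
    (fun q => (‖z₀‖ + 1) ^ 2 * G q ^ 2) ?_ ?_ (hG.integrable_sq.const_mul _) ?_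
  · exact Eventually.of_forall fun z => aestronglyMeasurable_compExp_mul hG.1 z
  · have h1 : ∀ᶠ z in 𝓝[{z : ℂ | 0 ≤ z.im}] z₀, ‖z‖ < ‖z₀‖ + 1 :=
      (continuous_norm.continuousWithinAt.eventually_lt continuousWithinAt_const (by simp))
    filter_upwards [h1, self_mem_nhdsWithin] with z hz hz'
    filter_upwards [hG0] with q hq
    refine (norm_compExp_le (im_mul_ofReal_nonneg (mul_nonneg hz' hq))).trans ?_
    rw [norm_mul, mul_pow, Complex.norm_real, Real.norm_eq_abs, sq_abs]
    gcongr
  · refine Eventually.of_forall fun q => ?_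
    exact ((continuous_compExp.comp (continuous_mul_const _)).tendsto z₀).mono_left
      nhdsWithin_le_nhds

lemma differentiableAt_levyExponent (hG : MemLp G 2 M) (hG0 : ∀ᵐ q ∂M, 0 ≤ G q) {z₀ : ℂ}
    (hz₀ : 0 < z₀.im) : DifferentiableAt ℂ (levyExponent M G) z₀ := by
  have hopen : {z : ℂ | 0 < z.im} ∩ Metric.ball 0 (‖z₀‖ + 1) ∈ 𝓝 z₀ :=
    ((isOpen_lt continuous_const Complex.continuous_im).inter Metric.isOpen_ball).mem_nhds
      ⟨hz₀, by simp⟩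
  refine (hasDerivAt_integral_of_dominated_loc_of_deriv_le
    (F := fun z q => compExp (z * (G q : ℂ)))
    (F' := fun z q => Complex.I * (Complex.exp (Complex.I * (z * (G q : ℂ))) - 1) * (G q : ℂ))
    (bound := fun q => (‖z₀‖ + 1) * G q ^ 2) hopen ?_ ?_ ?_ ?_
    (hG.integrable_sq.const_mul _) ?_).2.differentiableAt
  · exact Eventually.of_forall fun z => aestronglyMeasurable_compExp_mul hG.1 z
  · exact integrable_compExp hG
      (by filter_upwards [hG0] with q hq using mul_nonneg hz₀.le hq)
  · have : Continuous fun r : ℝ =>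
        Complex.I * (Complex.exp (Complex.I * (z₀ * (r : ℂ))) - 1) * (r : ℂ) := by fun_prop
    exact this.comp_aestronglyMeasurable hG.1
  · filter_upwards [hG0] with q hq z hz
    rw [norm_mul, norm_mul, Complex.norm_I, one_mul]
    have h1 := norm_exp_I_mul_sub_one_le (z := z * (G q : ℂ))
      (im_mul_ofReal_nonneg (mul_nonneg (le_of_lt hz.1) hq))
    have h2 : ‖z‖ ≤ ‖z₀‖ + 1 := by simpa using (Metric.mem_ball.1 hz.2).le
    rw [norm_mul, Complex.norm_real] at h1
    calc _ ≤ (‖z‖ * ‖G q‖) * ‖G q‖ := by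
          rw [Complex.norm_real]; gcongr
      _ = ‖z‖ * G q ^ 2 := by rw [mul_assoc, ← sq, Real.norm_eq_abs, sq_abs]
      _ ≤ _ := by gcongr
  · refine Eventually.of_forall fun q z _ => ?_
    have h1 : HasDerivAt (fun z : ℂ => z * (G q : ℂ)) (G q : ℂ) z := by
      simpa using (hasDerivAt_id z).mul_const (G q : ℂ)
    exact (hasDerivAt_compExp _).comp z h1

end Exponent

/-- Shift of a horizontal contour through the strip `0 ≤ Im z ≤ 1` for a function with Gaussian
decay. -/
lemma integral_eq_integral_add_I {f : ℂ → ℂ} {C b : ℝ} (hb : 0 < b)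
    (hc : ContinuousOn f {z | 0 ≤ z.im}) (hd : ∀ z : ℂ, 0 < z.im → DifferentiableAt ℂ f z)
    (hf : ∀ x y : ℝ, 0 ≤ y → y ≤ 1 → ‖f (x + y * Complex.I)‖ ≤ C * Real.exp (-b * x ^ 2)) :
    ∫ x : ℝ, f x = ∫ x : ℝ, f (x + Complex.I) := by
  have hint : ∀ y : ℝ, 0 ≤ y → y ≤ 1 → Integrable fun x : ℝ => f (x + y * Complex.I) := by
    intro y hy hy1
    refine Integrable.mono' ((integrable_exp_neg_mul_sq hb).const_mul C) ?_
      (Eventually.of_forall fun x => hf x y hy hy1)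
    have : Continuous fun x : ℝ => f (x + y * Complex.I) :=
      hc.comp_continuous (by fun_prop) (fun x => by simpa using hy)
    exact this.aestronglyMeasurable
  have h0 : Integrable fun x : ℝ => f x := by simpa using hint 0 le_rfl zero_le_one
  have h1 : Integrable fun x : ℝ => f (x + Complex.I) := by simpa using hint 1 zero_le_one le_rfl
  have hrect : ∀ T : ℝ, (∫ x in (-T)..T, f x) - (∫ x in (-T)..T, f (x + Complex.I)) =
      -(Complex.I • (∫ y in (0 : ℝ)..1, f (T + y * Complex.I)) -
        Complex.I • ∫ y in (0 : ℝ)..1, f ((-T : ℝ) + y * Complex.I)) := by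
    intro T
    have := Complex.integral_boundary_rect_eq_zero_of_continuousOn_of_differentiableOn f
      ((-T : ℝ) : ℂ) ((T : ℝ) + Complex.I)
      (hc.mono fun z hz => by
        have := hz.2
        simp at this
        exact this.1)
      (fun z hz => (hd z (by
        have := hz.2
        simp at this
        exact this.1)).differentiableWithinAt)
    simp only [Complex.ofReal_im, Complex.ofReal_re, Complex.add_re, Complex.add_im, Complex.I_re,
      Complex.I_im, add_zero, zero_add, Complex.ofReal_zero, zero_mul, Complex.ofReal_one,
      one_mul] at this
    linear_combination this
  have hvert : ∀ T : ℝ, ‖∫ y in (0 : ℝ)..1, f (T + y * Complex.I)‖ ≤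
      C * Real.exp (-b * T ^ 2) := by
    intro T
    have := intervalIntegral.norm_integral_le_of_norm_le_const (a := 0) (b := 1)
      (f := fun y : ℝ => f (T + y * Complex.I)) (C := C * Real.exp (-b * T ^ 2))
      (fun y hy => by
        rw [uIoc_of_le zero_le_one] at hy
        exact hf T y hy.1.le hy.2)
    simpa using this
  have hdecay : Tendsto (fun T : ℝ => C * Real.exp (-b * T ^ 2) + C * Real.exp (-b * T ^ 2))
      atTop (𝓝 0) := by
    have h : Tendsto (fun T : ℝ => Real.exp (-b * T ^ 2)) atTop (𝓝 0) := by
      refine Real.tendsto_exp_atBot.comp ?_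
      simp_rw [neg_mul]
      exact tendsto_neg_atTop_atBot.comp ((tendsto_pow_atTop two_ne_zero).const_mul_atTop hb)
    simpa using (h.const_mul C).add (h.const_mul C)
  have hlim := (intervalIntegral_tendsto_integral h0 tendsto_neg_atTop_atBot tendsto_id).sub
    (intervalIntegral_tendsto_integral h1 tendsto_neg_atTop_atBot tendsto_id)
  have hlim0 : Tendsto (fun T : ℝ => (∫ x in (-T)..T, f x) - (∫ x in (-T)..T, f (x + Complex.I)))
      atTop (𝓝 0) := by
    refine squeeze_zero_norm (fun T => ?_) hdecay
    rw [hrect, norm_neg]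
    refine (norm_sub_le _ _).trans ?_
    rw [norm_smul, norm_smul, Complex.norm_I, one_mul, one_mul]
    refine add_le_add (hvert T) ?_
    have := hvert (-T)
    rwa [neg_sq] at this
  exact sub_eq_zero.1 (tendsto_nhds_unique hlim hlim0)

/-! ### Second moments and Laplace transforms from characteristic functions -/

section Moments

variable {Ω β : Type*} [MeasurableSpace Ω] [MeasurableSpace β] {P : Measure Ω}
  [IsProbabilityMeasure P] {M : Measure β} {G : β → ℝ} {W : Ω → ℝ}

lemma integrable_cexp_I_mul (hW : AEStronglyMeasurable W P) (r : ℝ) :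
    Integrable (fun ω => Complex.exp (Complex.I * ((r : ℂ) * (W ω : ℂ)))) P := by
  refine Integrable.mono' (integrable_const (1 : ℝ)) ?_ (Eventually.of_forall fun ω => ?_)
  · have : Continuous fun x : ℝ => Complex.exp (Complex.I * ((r : ℂ) * (x : ℂ))) := by fun_prop
    exact this.comp_aestronglyMeasurable hW
  · exact norm_exp_I_mul_le_one (by simp)

/-- A random variable whose characteristic function has a Lévy exponent with square integrable
jumps has a second moment, controlled by that of the jumps. Fatou's lemma is applied to
`(sin (s W) / s)²` as `s → 0`. -/
lemma lintegral_sq_le_of_charFun (hWm : AEStronglyMeasurable W P) (hG : MemLp G 2 M)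
    (hW : ∀ r : ℝ, ∫ ω, Complex.exp (Complex.I * ((r : ℂ) * (W ω : ℂ))) ∂P =
      Complex.exp (levyExponent M G r)) :
    ∫⁻ ω, ENNReal.ofReal (W ω ^ 2) ∂P ≤ ENNReal.ofReal (2 * ∫ q, G q ^ 2 ∂M) := by
  have hlim : ∀ w : ℝ, Tendsto (fun s : ℝ => ENNReal.ofReal ((s⁻¹ * Real.sin (w * s)) ^ 2))
      (𝓝[≠] 0) (𝓝 (ENNReal.ofReal (w ^ 2))) := by
    intro w
    have h1 : HasDerivAt (fun s : ℝ => Real.sin (w * s)) w 0 := by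
      have := ((hasDerivAt_id (0 : ℝ)).const_mul w).sin
      simpa using this
    have h2 := h1.tendsto_slope_zero
    simp only [zero_add, mul_zero, Real.sin_zero, sub_zero, smul_eq_mul] at h2
    exact ENNReal.tendsto_ofReal (h2.pow 2)
  have hmeas : ∀ s : ℝ, AEMeasurable
      (fun ω => ENNReal.ofReal ((s⁻¹ * Real.sin (W ω * s)) ^ 2)) P := by
    intro s
    have : Measurable fun x : ℝ => ENNReal.ofReal ((s⁻¹ * Real.sin (x * s)) ^ 2) := by fun_prop
    exact this.comp_aemeasurable hWm.aemeasurable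
  have hbound : ∀ s : ℝ, s ≠ 0 →
      ∫⁻ ω, ENNReal.ofReal ((s⁻¹ * Real.sin (W ω * s)) ^ 2) ∂P ≤
        ENNReal.ofReal (2 * ∫ q, G q ^ 2 ∂M) := by
    intro s hs
    have hint := integrable_cexp_I_mul hWm (2 * s)
    have hfun : ∀ ω, (s⁻¹ * Real.sin (W ω * s)) ^ 2 =
        s⁻¹ ^ 2 / 2 * (1 - (Complex.exp (Complex.I * (((2 * s : ℝ) : ℂ) * (W ω : ℂ)))).re) := by
      intro ω
      have : Complex.I * (((2 * s : ℝ) : ℂ) * (W ω : ℂ)) =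
          ((2 * (W ω * s) : ℝ) : ℂ) * Complex.I := by push_cast; ring
      rw [this, Complex.exp_ofReal_mul_I_re, Real.cos_two_mul, mul_pow, Real.sin_sq]
      ring
    have hint2 : Integrable (fun ω => (s⁻¹ * Real.sin (W ω * s)) ^ 2) P := by
      simp_rw [hfun]
      exact ((integrable_const 1).sub hint.re).const_mul _
    rw [← ofReal_integral_eq_lintegral_ofReal hint2 (Eventually.of_forall fun ω => sq_nonneg _)]
    refine ENNReal.ofReal_le_ofReal ?_
    simp_rw [hfun]
    have hre : ∫ ω, (Complex.exp (Complex.I * (((2 * s : ℝ) : ℂ) * (W ω : ℂ)))).re ∂P =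
        (Complex.exp (levyExponent M G ((2 * s : ℝ) : ℂ))).re := by
      rw [← hW]; exact integral_re hint
    have hsub : ∫ ω, (1 - (Complex.exp (Complex.I * (((2 * s : ℝ) : ℂ) * (W ω : ℂ)))).re) ∂P =
        1 - (Complex.exp (levyExponent M G ((2 * s : ℝ) : ℂ))).re := by
      have hintre : Integrable
          (fun ω => (Complex.exp (Complex.I * (((2 * s : ℝ) : ℂ) * (W ω : ℂ)))).re) P := hint.re
      rw [← hre, integral_sub (integrable_const 1) hintre]
      simp
    rw [integral_const_mul, hsub]
    set E := levyExponent M G ((2 * s : ℝ) : ℂ) with hE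
    -- the characteristic function has modulus at most one
    have hE0 : E.re ≤ 0 := by
      have h1 : ‖Complex.exp E‖ ≤ 1 := by
        rw [hE, ← hW]
        refine (norm_integral_le_of_norm_le (integrable_const (1 : ℝ))
          (Eventually.of_forall fun ω => norm_exp_I_mul_le_one (by simp))).trans (by simp)
      rwa [Complex.norm_exp, Real.exp_le_one_iff] at h1
    have h2 : 1 - (Complex.exp E).re ≤ ‖E‖ := by
      have h3 := norm_exp_I_mul_sub_one_le (z := -Complex.I * E) (by simpa using hE0)
      have h4 : Complex.I * (-Complex.I * E) = E := by
        rw [← mul_assoc, mul_neg, Complex.I_mul_I]; ring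
      rw [h4, norm_mul, norm_neg, Complex.norm_I, one_mul] at h3
      have h5 := (abs_le.1 ((Complex.abs_re_le_norm _).trans h3)).1
      simp at h5
      linarith
    have h6 : ‖E‖ ≤ (2 * s) ^ 2 * ∫ q, G q ^ 2 ∂M := by
      have := norm_levyExponent_le hG (z := ((2 * s : ℝ) : ℂ)) (by simp)
      rwa [Complex.norm_real, Real.norm_eq_abs, sq_abs] at this
    calc s⁻¹ ^ 2 / 2 * (1 - (Complex.exp E).re)
        ≤ s⁻¹ ^ 2 / 2 * ((2 * s) ^ 2 * ∫ q, G q ^ 2 ∂M) := by gcongr; exact h2.trans h6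
      _ = 2 * ∫ q, G q ^ 2 ∂M := by field_simp
  calc ∫⁻ ω, ENNReal.ofReal (W ω ^ 2) ∂P
      = ∫⁻ ω, liminf (fun s : ℝ => ENNReal.ofReal ((s⁻¹ * Real.sin (W ω * s)) ^ 2)) (𝓝[≠] 0) ∂P :=
        lintegral_congr fun ω => (hlim (W ω)).liminf_eq.symm
    _ ≤ liminf (fun s : ℝ => ∫⁻ ω, ENNReal.ofReal ((s⁻¹ * Real.sin (W ω * s)) ^ 2) ∂P) (𝓝[≠] 0) :=
        lintegral_liminf_le' hmeas
    _ ≤ ENNReal.ofReal (2 * ∫ q, G q ^ 2 ∂M) := by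
        refine liminf_le_of_le (by isBoundedDefault) fun c hc => ?_
        have h7 : ∀ᶠ s : ℝ in 𝓝[≠] 0, s ≠ 0 := self_mem_nhdsWithin
        obtain ⟨s, h8, h9⟩ := (hc.and h7).exists
        exact h8.trans (hbound s h9)

/-- Gaussian regularization of the Laplace transform. Up to normalization, `e^{-w - w²/(4b)}` is the
Fourier integral of `e^{-b (x - i)²}`, and the contour shift `x ↦ x + i` centers this Gaussian. -/
lemma integral_exp_neg_sub_sq (hWm : AEStronglyMeasurable W P) (hG : MemLp G 2 M)
    (hG0 : ∀ᵐ q ∂M, 0 ≤ G q)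
    (hW : ∀ r : ℝ, ∫ ω, Complex.exp (Complex.I * ((r : ℂ) * (W ω : ℂ))) ∂P =
      Complex.exp (levyExponent M G r)) {b : ℝ} (hb : 0 < b) :
    ((∫ ω, Real.exp (-W ω - W ω ^ 2 / (4 * b)) ∂P : ℝ) : ℂ) * (Real.sqrt (Real.pi / b) : ℂ) =
      ∫ x : ℝ, Complex.exp (levyExponent M G (x + Complex.I)) * (Real.exp (-b * x ^ 2) : ℂ) := by
  have hshift := integral_eq_integral_add_I (C := Real.exp ((∫ q, G q ^ 2 ∂M) + b)) hb
    (f := fun z => Complex.exp (levyExponent M G z) * Complex.exp (-(b : ℂ) * (z - Complex.I) ^ 2))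
    (ContinuousOn.mul (Complex.continuous_exp.comp_continuousOn (continuousOn_levyExponent hG hG0))
      (by fun_prop))
    (fun z hz => (differentiableAt_levyExponent hG hG0 hz).cexp.mul (by fun_prop))
    (fun x y hy hy1 => by
      rw [norm_mul, Complex.norm_exp, Complex.norm_exp, ← Real.exp_add, ← Real.exp_add,
        Real.exp_le_exp]
      have h1 := re_levyExponent_le hG hG0 (z := (x : ℂ) + y * Complex.I) (by simpa using hy)
      have h2 : (-(b : ℂ) * ((x : ℂ) + y * Complex.I - Complex.I) ^ 2).re =
          -b * x ^ 2 + b * (1 - y) ^ 2 := by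
        have : (x : ℂ) + y * Complex.I - Complex.I = (x : ℂ) + ((y - 1 : ℝ) : ℂ) * Complex.I := by
          push_cast; ring
        rw [this]
        simp [sq]
        ring
      rw [h2]
      simp only [Complex.add_im, Complex.ofReal_im, Complex.mul_im, Complex.ofReal_re,
        Complex.I_im, mul_one, Complex.I_re, mul_zero, add_zero, zero_add] at h1
      have h3 : y ^ 2 * ∫ q, G q ^ 2 ∂M ≤ ∫ q, G q ^ 2 ∂M :=
        mul_le_of_le_one_left (integral_nonneg fun q => sq_nonneg _) (pow_le_one₀ hy hy1)
      have h4 : b * (1 - y) ^ 2 ≤ b :=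
        mul_le_of_le_one_right hb.le (pow_le_one₀ (by linarith) (by linarith))
      linarith)
  have hright : ∀ x : ℝ, Complex.exp (levyExponent M G (x + Complex.I)) *
      Complex.exp (-(b : ℂ) * (x + Complex.I - Complex.I) ^ 2) =
      Complex.exp (levyExponent M G (x + Complex.I)) * (Real.exp (-b * x ^ 2) : ℂ) := by
    intro x
    push_cast
    rw [add_sub_cancel_right]
  simp_rw [hright] at hshift
  rw [← hshift]
  have hprod : Integrable (Function.uncurry fun (x : ℝ) (ω : Ω) =>
      Complex.exp (Complex.I * ((x : ℂ) * (W ω : ℂ))) *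
        Complex.exp (-(b : ℂ) * ((x : ℂ) - Complex.I) ^ 2)) (volume.prod P) := by
    refine Integrable.mono' (g := fun p => Real.exp b * Real.exp (-b * p.1 ^ 2)) ?_ ?_ ?_
    · exact ((integrable_exp_neg_mul_sq hb).const_mul _).comp_fst P
    · have h1 : Continuous fun p : ℝ × ℝ => Complex.exp (Complex.I * ((p.1 : ℂ) * (p.2 : ℂ))) *
          Complex.exp (-(b : ℂ) * ((p.1 : ℂ) - Complex.I) ^ 2) := by fun_prop
      exact h1.comp_aestronglyMeasurable
        (f := fun p : ℝ × Ω => (p.1, W p.2))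
        (measurable_fst.aestronglyMeasurable.prodMk hWm.comp_snd)
    · refine Eventually.of_forall fun p => ?_
      simp only [Function.uncurry]
      rw [norm_mul]
      have h1 : ‖Complex.exp (Complex.I * ((p.1 : ℂ) * (W p.2 : ℂ)))‖ ≤ 1 :=
        norm_exp_I_mul_le_one (by simp)
      have h2 : ‖Complex.exp (-(b : ℂ) * ((p.1 : ℂ) - Complex.I) ^ 2)‖ =
          Real.exp b * Real.exp (-b * p.1 ^ 2) := by
        rw [Complex.norm_exp, ← Real.exp_add]
        congr 1
        simp [sq]
        ring
      rw [h2]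
      exact mul_le_of_le_one_left (by positivity) h1
  calc ((∫ ω, Real.exp (-W ω - W ω ^ 2 / (4 * b)) ∂P : ℝ) : ℂ) * (Real.sqrt (Real.pi / b) : ℂ)
      = ∫ ω, (∫ x : ℝ, Complex.exp (Complex.I * ((x : ℂ) * (W ω : ℂ))) *
          Complex.exp (-(b : ℂ) * ((x : ℂ) - Complex.I) ^ 2)) ∂P := by
        rw [← integral_complex_ofReal, ← integral_mul_const]
        congr 1
        ext ω
        have h1 : ∀ x : ℝ, Complex.exp (Complex.I * ((x : ℂ) * (W ω : ℂ))) *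
            Complex.exp (-(b : ℂ) * ((x : ℂ) - Complex.I) ^ 2) =
            Complex.exp ((-b : ℂ) * x ^ 2 + (Complex.I * W ω + 2 * b * Complex.I) * x + b) := by
          intro x
          rw [← Complex.exp_add]
          congr 1
          linear_combination (-(b : ℂ)) * Complex.I_sq
        simp_rw [h1]
        rw [integral_cexp_quadratic (by simpa using hb), mul_comm]
        congr 1
        · rw [neg_neg, Real.sqrt_eq_rpow, Complex.ofReal_cpow (by positivity)]
          push_cast
          rfl
        · rw [Complex.ofReal_exp]
          congr 1
          have : (b : ℂ) ≠ 0 := by exact_mod_cast hb.ne'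
          push_cast
          field_simp
          linear_combination (-((W ω : ℂ) + 2 * b) ^ 2) * Complex.I_sq
    _ = ∫ x : ℝ, (∫ ω, Complex.exp (Complex.I * ((x : ℂ) * (W ω : ℂ))) *
          Complex.exp (-(b : ℂ) * ((x : ℂ) - Complex.I) ^ 2) ∂P) :=
        (integral_integral_swap hprod).symm
    _ = _ := by
        congr 1
        ext x
        rw [integral_mul_const, hW]

/-- The Laplace transform of a centered infinitely divisible variable with nonnegative square
integrable jumps: the characteristic function may be continued to the frequency `i`. -/
lemma integral_exp_neg_of_charFun (hWm : AEStronglyMeasurable W P) (hG : MemLp G 2 M)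
    (hG0 : ∀ᵐ q ∂M, 0 ≤ G q)
    (hW : ∀ r : ℝ, ∫ ω, Complex.exp (Complex.I * ((r : ℂ) * (W ω : ℂ))) ∂P =
      Complex.exp (levyExponent M G r)) :
    Integrable (fun ω => Real.exp (-W ω)) P ∧
      ∫ ω, Real.exp (-W ω) ∂P = Real.exp (∫ q, (Real.exp (-G q) - 1 + G q) ∂M) := by
  set L : ℝ := ∫ q, (Real.exp (-G q) - 1 + G q) ∂M with hL
  set S : ℝ := ∫ q, G q ^ 2 ∂M with hS
  let g : ℕ → Ω → ℝ := fun n ω => Real.exp (-W ω - W ω ^ 2 / (4 * ((n : ℝ) + 1) ^ 2))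
  -- the regularization with `b = (n + 1)²`, after the substitution `x = u / (n + 1)`
  have hval : ∀ n : ℕ, ((∫ ω, g n ω ∂P : ℝ) : ℂ) * (Real.sqrt Real.pi : ℂ) =
      ∫ u : ℝ, Complex.exp (levyExponent M G (((u / ((n : ℝ) + 1) : ℝ) : ℂ) + Complex.I)) *
        (Real.exp (-u ^ 2) : ℂ) := by
    intro n
    have hn : (0 : ℝ) < (n : ℝ) + 1 := by positivity
    have h1 := integral_exp_neg_sub_sq hWm hG hG0 hW (b := ((n : ℝ) + 1) ^ 2) (by positivity)
    have h2 := Measure.integral_comp_div (fun x : ℝ =>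
      Complex.exp (levyExponent M G ((x : ℂ) + Complex.I)) *
        (Real.exp (-((n : ℝ) + 1) ^ 2 * x ^ 2) : ℂ)) ((n : ℝ) + 1)
    have h3 : ∀ u : ℝ, -((n : ℝ) + 1) ^ 2 * (u / ((n : ℝ) + 1)) ^ 2 = -u ^ 2 := by
      intro u; field_simp
    simp_rw [h3] at h2
    rw [h2, ← h1, abs_of_pos hn, Real.sqrt_div' _ (by positivity), Real.sqrt_sq hn.le,
      Complex.real_smul]
    have : (((n : ℝ) + 1 : ℝ) : ℂ) ≠ 0 := by exact_mod_cast hn.ne'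
    rw [Complex.ofReal_div, mul_comm (((n : ℝ) + 1 : ℝ) : ℂ), mul_assoc, div_mul_cancel₀ _ this]
  have hnorm : ∀ x : ℝ, ‖Complex.exp (levyExponent M G ((x : ℂ) + Complex.I))‖ ≤ Real.exp S := by
    intro x
    rw [Complex.norm_exp, Real.exp_le_exp]
    simpa using re_levyExponent_le hG hG0 (z := (x : ℂ) + Complex.I) (by simp)
  have hgauss : Integrable fun u : ℝ => Real.exp (-u ^ 2) := by
    simpa using integrable_exp_neg_mul_sq one_pos
  have hgaussval : ∫ u : ℝ, Real.exp (-u ^ 2) = Real.sqrt Real.pi := by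
    simpa using integral_gaussian 1
  have hcont : Continuous fun x : ℝ => Complex.exp (levyExponent M G ((x : ℂ) + Complex.I)) :=
    Complex.continuous_exp.comp ((continuousOn_levyExponent hG hG0).comp_continuous
      (by fun_prop) (fun x => by simp))
  have hlim : Tendsto (fun n : ℕ => ∫ u : ℝ,
      Complex.exp (levyExponent M G (((u / ((n : ℝ) + 1) : ℝ) : ℂ) + Complex.I)) *
        (Real.exp (-u ^ 2) : ℂ)) atTop
      (𝓝 (∫ u : ℝ, (Real.exp L : ℂ) * (Real.exp (-u ^ 2) : ℂ))) := by
    refine tendsto_integral_of_dominated_convergence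
      (fun u => Real.exp S * Real.exp (-u ^ 2)) (fun n => ?_) (hgauss.const_mul _)
      (fun n => Eventually.of_forall fun u => ?_) (Eventually.of_forall fun u => ?_)
    · exact ((hcont.comp (continuous_id.div_const _)).mul (by fun_prop)).aestronglyMeasurable
    · rw [norm_mul, Complex.norm_real, Real.norm_eq_abs, abs_of_pos (Real.exp_pos _)]
      gcongr
      exact hnorm _
    · have h1 : Tendsto (fun n : ℕ => u / ((n : ℝ) + 1)) atTop (𝓝 0) :=
        tendsto_const_nhds.div_atTop
          (tendsto_natCast_atTop_atTop.atTop_add tendsto_const_nhds)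
      have h2 := (hcont.tendsto 0).comp h1
      simp only [Complex.ofReal_zero, zero_add, levyExponent_I, ← Complex.ofReal_exp] at h2
      exact h2.mul_const _
  have hlimg : Tendsto (fun n : ℕ => ∫ ω, g n ω ∂P) atTop (𝓝 (Real.exp L)) := by
    simp_rw [← hval] at hlim
    rw [integral_const_mul, integral_complex_ofReal, hgaussval] at hlim
    have hpi : Real.sqrt Real.pi ≠ 0 := by positivity
    have h1 : Tendsto (fun n : ℕ => (∫ ω, g n ω ∂P) * Real.sqrt Real.pi) atTop
        (𝓝 (Real.exp L * Real.sqrt Real.pi)) := by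
      have := (Complex.continuous_re.tendsto _).comp hlim
      simpa only [Function.comp_def, ← Complex.ofReal_mul, Complex.ofReal_re] using this
    simpa [mul_div_assoc, hpi] using h1.div_const (Real.sqrt Real.pi)
  have hgm : ∀ n, AEStronglyMeasurable (g n) P := by
    intro n
    have : Continuous fun x : ℝ => Real.exp (-x - x ^ 2 / (4 * ((n : ℝ) + 1) ^ 2)) := by fun_prop
    exact this.comp_aestronglyMeasurable hWm
  have hptw : ∀ ω, Tendsto (fun n => g n ω) atTop (𝓝 (Real.exp (-W ω))) := by
    intro ω
    have h1 : Tendsto (fun n : ℕ => 4 * ((n : ℝ) + 1) ^ 2) atTop atTop :=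
      ((tendsto_pow_atTop two_ne_zero).comp
        (tendsto_natCast_atTop_atTop.atTop_add tendsto_const_nhds)).const_mul_atTop (by norm_num)
    have h2 : Tendsto (fun n : ℕ => W ω ^ 2 / (4 * ((n : ℝ) + 1) ^ 2)) atTop (𝓝 0) :=
      tendsto_const_nhds.div_atTop h1
    have h3 := (Real.continuous_exp.tendsto _).comp (tendsto_const_nhds (x := -W ω) |>.sub h2)
    simpa only [g, Function.comp_def, sub_zero] using h3
  -- completing the square, each regularization is bounded
  have hgint : ∀ n, Integrable (g n) P := by
    intro n
    refine Integrable.mono' (integrable_const (Real.exp (((n : ℝ) + 1) ^ 2))) (hgm n)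
      (Eventually.of_forall fun ω => ?_)
    rw [Real.norm_eq_abs, abs_of_pos (Real.exp_pos _), Real.exp_le_exp]
    have hn : (0 : ℝ) < (n : ℝ) + 1 := by positivity
    have h1 : -W ω - W ω ^ 2 / (4 * ((n : ℝ) + 1) ^ 2) =
        ((n : ℝ) + 1) ^ 2 - (W ω / (2 * ((n : ℝ) + 1)) + ((n : ℝ) + 1)) ^ 2 := by
      field_simp; ring
    rw [h1]
    linarith [sq_nonneg (W ω / (2 * ((n : ℝ) + 1)) + ((n : ℝ) + 1))]
  have hm : AEStronglyMeasurable (fun ω => Real.exp (-W ω)) P :=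
    (by fun_prop : Continuous fun x : ℝ => Real.exp (-x)).comp_aestronglyMeasurable hWm
  have hint : Integrable (fun ω => Real.exp (-W ω)) P := by
    refine ⟨hm, ?_⟩
    rw [hasFiniteIntegral_iff_ofReal (Eventually.of_forall fun ω => (Real.exp_pos _).le)]
    calc ∫⁻ ω, ENNReal.ofReal (Real.exp (-W ω)) ∂P
        = ∫⁻ ω, liminf (fun n => ENNReal.ofReal (g n ω)) atTop ∂P :=
          lintegral_congr fun ω => (ENNReal.tendsto_ofReal (hptw ω)).liminf_eq.symm
      _ ≤ liminf (fun n => ∫⁻ ω, ENNReal.ofReal (g n ω) ∂P) atTop :=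
          lintegral_liminf_le' fun n => (hgm n).aemeasurable.ennreal_ofReal
      _ = ENNReal.ofReal (Real.exp L) := by
          have : ∀ n, ∫⁻ ω, ENNReal.ofReal (g n ω) ∂P = ENNReal.ofReal (∫ ω, g n ω ∂P) := fun n =>
            (ofReal_integral_eq_lintegral_ofReal (hgint n)
              (Eventually.of_forall fun ω => (Real.exp_pos _).le)).symm
          simp_rw [this]
          exact (ENNReal.tendsto_ofReal hlimg).liminf_eq
      _ < ⊤ := ENNReal.ofReal_lt_top
  refine ⟨hint, tendsto_nhds_unique ?_ hlimg⟩
  refine tendsto_integral_of_dominated_convergence (fun ω => Real.exp (-W ω)) hgm hint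
    (fun n => Eventually.of_forall fun ω => ?_) (Eventually.of_forall hptw)
  rw [Real.norm_eq_abs, abs_of_pos (Real.exp_pos _), Real.exp_le_exp]
  have : 0 ≤ W ω ^ 2 / (4 * ((n : ℝ) + 1) ^ 2) := by positivity
  linarith

end Moments

/-! ### Integrals of paths in `L²` and pointwise integrals -/

section BochnerPointwise

variable {α : Type*} [MeasurableSpace α] {μ : Measure α}

lemma toReal_eLpNorm_two_sq {G : α → ℝ} (hG : MemLp G 2 μ) :
    (eLpNorm G 2 μ).toReal ^ 2 = ∫ q, G q ^ 2 ∂μ := by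
  rw [← Lp.norm_toLp G hG, ← real_inner_self_eq_norm_sq, L2.inner_def]
  refine integral_congr_ae ?_
  filter_upwards [hG.coeFn_toLp] with q hq
  simp [hq, sq]

lemma norm_Lp_two_sq (x : Lp ℝ 2 μ) : ‖x‖ ^ 2 = ∫ q, x q ^ 2 ∂μ := by
  rw [Lp.norm_def, toReal_eLpNorm_two_sq (Lp.memLp x)]

variable {x : ℝ → Lp ℝ 2 μ} {F : ℝ → α → ℝ}

lemma integrable_uncurry_of_continuous_Lp [SigmaFinite μ] (hx : Continuous x)
    (hF : Measurable (Function.uncurry F)) (hxF : ∀ u, x u =ᵐ[μ] F u) (a b : ℝ) {A : Set α}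
    (hA : μ A ≠ ⊤) :
    Integrable (Function.uncurry F) ((volume.restrict (Ioc a b)).prod (μ.restrict A)) := by
  have : IsFiniteMeasure (μ.restrict A) := isFiniteMeasure_restrict.2 hA
  have hmem : ∀ u, MemLp (F u) 2 μ := fun u => (Lp.memLp (x u)).ae_eq (hxF u)
  rw [integrable_prod_iff hF.aestronglyMeasurable]
  refine ⟨Eventually.of_forall fun u => ((hmem u).restrict A).integrable one_le_two, ?_⟩
  obtain ⟨C, hC⟩ := (isCompact_Icc (a := a) (b := b)).exists_bound_of_continuousOn
    (f := fun u => μ.real A + ‖x u‖ ^ 2) (by fun_prop)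
  refine Integrable.mono' (integrable_const C)
    hF.stronglyMeasurable.norm.integral_prod_right.aestronglyMeasurable ?_
  filter_upwards [ae_restrict_mem measurableSet_Ioc] with u hu
  have h0 : 0 ≤ ∫ ω, ‖F u ω‖ ∂μ.restrict A := integral_nonneg fun _ => norm_nonneg _
  simp only [Function.uncurry]
  rw [Real.norm_eq_abs, abs_of_nonneg h0]
  refine le_trans ?_ ((le_abs_self _).trans (hC u (Ioc_subset_Icc_self hu)))
  have hsq : Integrable (fun ω => F u ω ^ 2) μ := (hmem u).integrable_sq
  calc ∫ ω, ‖F u ω‖ ∂μ.restrict A ≤ ∫ ω, (1 + F u ω ^ 2) ∂μ.restrict A := by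
        refine integral_mono (((hmem u).restrict A).integrable one_le_two).norm
          ((integrable_const 1).add hsq.restrict) fun ω => ?_
        simp only [Real.norm_eq_abs]
        nlinarith [sq_nonneg (|F u ω| - 1), sq_abs (F u ω), abs_nonneg (F u ω)]
    _ = μ.real A + ∫ ω in A, F u ω ^ 2 ∂μ := by
        rw [integral_add (integrable_const 1) hsq.restrict]; simp
    _ ≤ μ.real A + ∫ ω, F u ω ^ 2 ∂μ := by
        exact add_le_add_right
          (setIntegral_le_integral hsq (Eventually.of_forall fun ω => sq_nonneg _)) _
    _ = μ.real A + ‖x u‖ ^ 2 := by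
        rw [norm_Lp_two_sq]
        congr 1
        refine integral_congr_ae ?_
        filter_upwards [hxF u] with ω hω
        rw [hω]

lemma ae_intervalIntegrable_of_continuous_Lp [SigmaFinite μ] (hx : Continuous x)
    (hF : Measurable (Function.uncurry F)) (hxF : ∀ u, x u =ᵐ[μ] F u) {a b : ℝ} (hab : a ≤ b) :
    ∀ᵐ ω ∂μ, IntervalIntegrable (fun u => F u ω) volume a b := by
  have h : ∀ n, ∀ᵐ ω ∂μ, ω ∈ spanningSets μ n →
      IntervalIntegrable (fun u => F u ω) volume a b := by
    intro n
    rw [← ae_restrict_iff' (measurableSet_spanningSets μ n)]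
    have := (integrable_uncurry_of_continuous_Lp hx hF hxF a b
      (measure_spanningSets_lt_top μ n).ne).swap.prod_right_ae
    filter_upwards [this] with ω hω
    exact (intervalIntegrable_iff_integrableOn_Ioc_of_le hab).2 hω
  filter_upwards [ae_all_iff.2 h] with ω hω
  exact hω _ (mem_spanningSetsIndex μ ω)

/-- The Bochner integral of a continuous path in `L²` is represented by the pointwise integral of
any jointly measurable family of representatives. -/
lemma coeFn_intervalIntegral_Lp [SigmaFinite μ] (hx : Continuous x)
    (hF : Measurable (Function.uncurry F)) (hxF : ∀ u, x u =ᵐ[μ] F u) {a b : ℝ} (hab : a ≤ b) :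
    (∫ u in a..b, x u : Lp ℝ 2 μ) =ᵐ[μ] fun ω => ∫ u in a..b, F u ω := by
  refine ae_eq_of_forall_setIntegral_eq_of_sigmaFinite (fun A hA hμA => ?_) (fun A hA hμA => ?_)
    fun A hA hμA => ?_
  · have : IsFiniteMeasure (μ.restrict A) := isFiniteMeasure_restrict.2 hμA.ne
    exact ((Lp.memLp _).restrict A).integrable one_le_two
  · have := (integrable_uncurry_of_continuous_Lp hx hF hxF a b hμA.ne).swap.integral_prod_left
    simp only [intervalIntegral.integral_of_le hab]
    exact this
  · have hint := integrable_uncurry_of_continuous_Lp hx hF hxF a b hμA.ne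
    have h1 : ∀ y : Lp ℝ 2 μ, ∫ ω in A, y ω ∂μ =
        innerSL ℝ (indicatorConstLp 2 hA hμA.ne (1 : ℝ)) y := fun y => by
      rw [innerSL_apply_apply, L2.inner_indicatorConstLp_one]
    rw [h1, ← (innerSL ℝ (indicatorConstLp 2 hA hμA.ne (1 : ℝ))).intervalIntegral_comp_comm
      (hx.intervalIntegrable a b)]
    simp_rw [← h1, intervalIntegral.integral_of_le hab]
    rw [integral_integral_swap (f := fun ω u => F u ω) hint.swap]
    refine integral_congr_ae (Eventually.of_forall fun u => ?_)
    exact integral_congr_ae (ae_restrict_of_ae (hxF u))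

/-- A closed subspace contains the integrals of the continuous paths that run in it. -/
lemma intervalIntegral_mem_of_isClosed {E : Type*} [NormedAddCommGroup E] [NormedSpace ℝ E]
    [CompleteSpace E] {K : Submodule ℝ E} (hK : IsClosed (K : Set E)) {y : ℝ → E}
    (hy : Continuous y) (hyK : ∀ u, y u ∈ K) (a b : ℝ) : ∫ u in a..b, y u ∈ K := by
  have : CompleteSpace K := hK.completeSpace_coe
  have hc : Continuous fun u => (⟨y u, hyK u⟩ : K) := hy.subtype_mk hyK
  have := K.subtypeL.intervalIntegral_comp_comm (hc.intervalIntegrable (μ := volume) a b)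
  simp only [Submodule.subtypeL_apply] at this
  rw [this]
  exact Submodule.coe_mem _

end BochnerPointwise

lemma aestronglyMeasurable_intervalIntegral_Lp {α : Type*} {m m0 : MeasurableSpace α}
    {μ : Measure α} (hm : m ≤ m0) {x : ℝ → Lp ℝ 2 μ} (hx : Continuous x)
    (hxm : ∀ u, AEStronglyMeasurable[m] (x u) μ) (a b : ℝ) :
    AEStronglyMeasurable[m] (∫ u in a..b, x u : Lp ℝ 2 μ) μ := by
  have h1 : IsClosed (lpMeas ℝ ℝ m 2 μ : Set (Lp ℝ 2 μ)) := isClosed_aestronglyMeasurable hm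
  exact mem_lpMeas_iff_aestronglyMeasurable.1 (intervalIntegral_mem_of_isClosed h1 hx
    (fun u => mem_lpMeas_iff_aestronglyMeasurable.2 (hxm u)) a b)

/-! ### The extension of the noise to `L²` -/

section Jumps

variable {σ : Measure ℝ}

/-- The intensity `dx dy σ(dτ)` of the jumps of the noise, as a measure on position-size pairs. -/
def jumpMeasure (σ : Measure ℝ) : Measure ((ℝ × ℝ) × ℝ) := volume.prod (σ.restrict (Ioi 0))

/-- The jump `τ f(x, y)` that a jump of the noise of size `τ` at `(x, y)` causes in `⟨·, f⟩`. -/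
def jumpOf (f : ℝ × ℝ → ℝ) (q : (ℝ × ℝ) × ℝ) : ℝ := q.2 * f q.1

/-- The second moment `∫ τ² σ(dτ)` of the Lévy measure. -/
def secondMoment (σ : Measure ℝ) : ℝ := ∫ τ in Ioi (0 : ℝ), τ ^ 2 ∂σ

/-- A measure integrating `τ²` on `(0, ∞)` is finite on each `(1 / n, ∞)`. -/
lemma sigmaFinite_restrict_Ioi (hσ : IntegrableOn (fun τ : ℝ => τ ^ 2) (Ioi 0) σ) :
    SigmaFinite (σ.restrict (Ioi 0)) := by
  have h : ∀ n : ℕ, σ (Ioi 0 ∩ {τ : ℝ | 1 / ((n : ℝ) + 1) ≤ τ ^ 2}) < ⊤ := by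
    intro n
    have := hσ.measure_norm_ge_lt_top (ε := 1 / ((n : ℝ) + 1)) (by positivity)
    rw [Measure.restrict_apply₀' measurableSet_Ioi.nullMeasurableSet] at this
    refine lt_of_le_of_lt (measure_mono fun τ hτ => ?_) this
    exact ⟨by simpa using hτ.2, hτ.1⟩
  refine ⟨⟨⟨fun n => {τ : ℝ | 1 / ((n : ℝ) + 1) ≤ τ ^ 2} ∪ Iic 0, fun _ => trivial, fun n => ?_,
    ?_⟩⟩⟩
  · rw [Measure.restrict_apply₀' measurableSet_Ioi.nullMeasurableSet]
    refine lt_of_le_of_lt (measure_mono fun τ hτ => ?_) (h n)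
    rcases hτ.1 with h1 | h1
    · exact ⟨hτ.2, h1⟩
    · exact absurd (mem_Ioi.1 hτ.2) (not_lt.2 h1)
  · refine eq_univ_of_forall fun τ => ?_
    rcases le_or_gt τ 0 with h0 | h0
    · exact mem_iUnion.2 ⟨0, Or.inr h0⟩
    · obtain ⟨n, hn⟩ := exists_nat_one_div_lt (pow_pos h0 2)
      exact mem_iUnion.2 ⟨n, Or.inl hn.le⟩

lemma jumpOf_congr (hσ : IntegrableOn (fun τ : ℝ => τ ^ 2) (Ioi 0) σ) {f g : ℝ × ℝ → ℝ}
    (h : f =ᵐ[volume] g) : jumpOf f =ᵐ[jumpMeasure σ] jumpOf g := by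
  have := sigmaFinite_restrict_Ioi hσ
  have h1 := (Measure.quasiMeasurePreserving_fst (μ := (volume : Measure (ℝ × ℝ)))
    (ν := σ.restrict (Ioi 0))).ae_eq_comp h
  filter_upwards [h1] with q hq
  simp only [Function.comp] at hq
  simp [jumpOf, hq]

lemma ae_jumpMeasure_pos (hσ : IntegrableOn (fun τ : ℝ => τ ^ 2) (Ioi 0) σ) :
    ∀ᵐ q ∂jumpMeasure σ, 0 < q.2 := by
  have := sigmaFinite_restrict_Ioi hσ
  have h1 := (Measure.quasiMeasurePreserving_snd (μ := (volume : Measure (ℝ × ℝ)))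
    (ν := σ.restrict (Ioi 0))).ae (ae_restrict_mem measurableSet_Ioi)
  exact h1

lemma integral_jumpOf_sq (hσ : IntegrableOn (fun τ : ℝ => τ ^ 2) (Ioi 0) σ) (f : ℝ × ℝ → ℝ) :
    ∫ q, jumpOf f q ^ 2 ∂jumpMeasure σ = secondMoment σ * ∫ p, f p ^ 2 := by
  have := sigmaFinite_restrict_Ioi hσ
  have := integral_prod_mul (μ := (volume : Measure (ℝ × ℝ))) (ν := σ.restrict (Ioi 0))
    (fun p => f p ^ 2) (fun τ => τ ^ 2)
  rw [secondMoment, mul_comm, ← this, jumpMeasure]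
  congr 1
  ext q
  simp only [jumpOf]
  ring

lemma memLp_jumpOf (hσ : IntegrableOn (fun τ : ℝ => τ ^ 2) (Ioi 0) σ) {f : ℝ × ℝ → ℝ}
    (hf : MemLp f 2 volume) : MemLp (jumpOf f) 2 (jumpMeasure σ) := by
  have := sigmaFinite_restrict_Ioi hσ
  have hm : AEStronglyMeasurable (jumpOf f) (jumpMeasure σ) :=
    measurable_snd.aestronglyMeasurable.mul hf.1.comp_fst
  rw [memLp_two_iff_integrable_sq hm]
  refine (hf.integrable_sq.mul_prod (ν := σ.restrict (Ioi 0)) (g := fun τ => τ ^ 2) hσ).congr ?_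
  exact Eventually.of_forall fun q => by simp only [jumpOf]; ring

lemma jumpOf_smul (r : ℝ) (f : ℝ × ℝ → ℝ) : jumpOf (r • f) = fun q => r * jumpOf f q := by
  ext q; simp only [jumpOf, Pi.smul_apply, smul_eq_mul]; ring

lemma levyExponent_congr {β : Type*} [MeasurableSpace β] {M : Measure β} {G H : β → ℝ}
    (h : G =ᵐ[M] H) (z : ℂ) : levyExponent M G z = levyExponent M H z := by
  refine integral_congr_ae ?_
  filter_upwards [h] with q hq
  rw [hq]

lemma continuous_levyExponent_jumpOf (hσ : IntegrableOn (fun τ : ℝ => τ ^ 2) (Ioi 0) σ) :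
    Continuous fun f : Lp ℝ 2 (volume : Measure (ℝ × ℝ)) =>
      levyExponent (jumpMeasure σ) (jumpOf f) 1 := by
  have hnorm : ∀ {g : ℝ × ℝ → ℝ}, MemLp g 2 volume →
      (eLpNorm (jumpOf g) 2 (jumpMeasure σ)).toReal =
        Real.sqrt (secondMoment σ) * (eLpNorm g 2 volume).toReal := by
    intro g hg
    have h0 : 0 ≤ secondMoment σ := integral_nonneg fun τ => sq_nonneg τ
    rw [← sq_eq_sq₀ ENNReal.toReal_nonneg (by positivity), mul_pow, Real.sq_sqrt h0,
      toReal_eLpNorm_two_sq (memLp_jumpOf hσ hg), toReal_eLpNorm_two_sq hg, integral_jumpOf_sq hσ]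
  refine continuous_iff_continuousAt.2 fun f => tendsto_iff_norm_sub_tendsto_zero.2 ?_
  have hbound : ∀ g : Lp ℝ 2 (volume : Measure (ℝ × ℝ)),
      ‖levyExponent (jumpMeasure σ) (jumpOf g) 1 - levyExponent (jumpMeasure σ) (jumpOf f) 1‖ ≤
        (Real.sqrt (secondMoment σ) * ‖g‖ + Real.sqrt (secondMoment σ) * ‖f‖) *
          (Real.sqrt (secondMoment σ) * ‖g - f‖) := by
    intro g
    have h1 := norm_levyExponent_sub_le (memLp_jumpOf hσ (Lp.memLp g))
      (memLp_jumpOf hσ (Lp.memLp f))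
    have h2 : (fun q => jumpOf g q - jumpOf f q) =ᵐ[jumpMeasure σ] jumpOf (g - f : Lp ℝ 2 _) := by
      refine EventuallyEq.trans (Eventually.of_forall fun q => ?_)
        (jumpOf_congr hσ (Lp.coeFn_sub g f).symm)
      simp only [jumpOf, Pi.sub_apply]
      ring
    rwa [eLpNorm_congr_ae h2, hnorm (Lp.memLp _), hnorm (Lp.memLp _), hnorm (Lp.memLp _),
      ← Lp.norm_def, ← Lp.norm_def, ← Lp.norm_def] at h1
  refine squeeze_zero (fun g => norm_nonneg _) hbound ?_
  have : Continuous fun g : Lp ℝ 2 (volume : Measure (ℝ × ℝ)) =>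
      (Real.sqrt (secondMoment σ) * ‖g‖ + Real.sqrt (secondMoment σ) * ‖f‖) *
          (Real.sqrt (secondMoment σ) * ‖g - f‖) := by fun_prop
  simpa using this.tendsto f

end Jumps

section Graph

variable {σ : Measure ℝ} {ν : Measure Dist}

lemma measurable_eval (φ : TestFn) : Measurable fun ω : Dist => ω φ :=
  (comap_measurable _).mono (le_iSup (fun φ : TestFn => (borel ℝ).comap fun ω : Dist => ω φ) φ)
    le_rfl

/-- The pairs `(φ, ⟨·, φ⟩)` with a test function `φ` for which `⟨·, φ⟩` is square integrable. -/
def testGraph (ν : Measure Dist) :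
    Submodule ℝ (Lp ℝ 2 (volume : Measure (ℝ × ℝ)) × Lp ℝ 2 ν) where
  carrier := {z | ∃ φ : TestFn, z.1 =ᵐ[volume] φ ∧ z.2 =ᵐ[ν] fun ω => ω φ}
  zero_mem' := ⟨0, Lp.coeFn_zero _ _ _,
    (Lp.coeFn_zero _ _ _).trans (Eventually.of_forall fun ω => (map_zero ω).symm)⟩
  add_mem' := by
    rintro z w ⟨φ, h1, h2⟩ ⟨ψ, h3, h4⟩
    exact ⟨φ + ψ, (Lp.coeFn_add _ _).trans (h1.add h3), (Lp.coeFn_add _ _).trans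
      ((h2.add h4).trans (Eventually.of_forall fun ω => (map_add ω φ ψ).symm))⟩
  smul_mem' := by
    rintro r z ⟨φ, h1, h2⟩
    exact ⟨r • φ, (Lp.coeFn_smul _ _).trans (h1.const_smul r),
      (Lp.coeFn_smul _ _).trans
        ((h2.const_smul r).trans (Eventually.of_forall fun ω => (map_smul ω r φ).symm))⟩

lemma mem_testGraph {z : Lp ℝ 2 (volume : Measure (ℝ × ℝ)) × Lp ℝ 2 ν} :
    z ∈ testGraph ν ↔ ∃ φ : TestFn, z.1 =ᵐ[volume] φ ∧ z.2 =ᵐ[ν] fun ω => ω φ := Iff.rfl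

/-- `Y` represents the value at `f ∈ L²` of the closure of the map `φ ↦ ⟨·, φ⟩`: the classes of `f`
and `Y` form a point of the closed linear subspace of `L² × L²(ν)` spanned by the test functions. -/
def Pairs (ν : Measure Dist) (f : ℝ × ℝ → ℝ) (Y : Dist → ℝ) : Prop :=
  ∃ z ∈ (testGraph ν).topologicalClosure, z.1 =ᵐ[volume] f ∧ z.2 =ᵐ[ν] Y

lemma IsPairing.pairs {f : ℝ × ℝ → ℝ} {Y : Dist → ℝ} (h : IsPairing ν f Y) : Pairs ν f Y := by
  obtain ⟨hf, hY, φ, h1, h2⟩ := h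
  refine ⟨(hf.toLp f, hY.toLp Y), ?_, hf.coeFn_toLp, hY.coeFn_toLp⟩
  -- all but finitely many of the approximants are square integrable
  have hφ : ∀ᶠ n in atTop, MemLp (fun p => φ n p) 2 (volume : Measure (ℝ × ℝ)) := by
    filter_upwards [h1.eventually (gt_mem_nhds (by simp : (0 : ENNReal) < ⊤))] with n hn
    have h3 : MemLp (fun p => φ n p - f p) 2 (volume : Measure (ℝ × ℝ)) :=
      ⟨(φ n).continuous.aestronglyMeasurable.sub hf.1, hn⟩
    simpa [Pi.add_def] using h3.add hf
  have hY' : ∀ᶠ n in atTop, MemLp (fun ω : Dist => ω (φ n)) 2 ν := by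
    filter_upwards [h2.eventually (gt_mem_nhds (by simp : (0 : ENNReal) < ⊤))] with n hn
    have h3 : MemLp (fun ω : Dist => ω (φ n) - Y ω) 2 ν :=
      ⟨(measurable_eval (φ n)).aestronglyMeasurable.sub hY.1, hn⟩
    simpa [Pi.add_def] using h3.add hY
  refine Metric.mem_closure_iff.2 fun ε hε => ?_
  have hε' : (0 : ENNReal) < ENNReal.ofReal ε := by simpa using hε
  obtain ⟨n, h3, h4, h5, h6⟩ := (hφ.and (hY'.and ((h1.eventually (gt_mem_nhds hε')).and
    (h2.eventually (gt_mem_nhds hε'))))).exists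
  refine ⟨(h3.toLp _, h4.toLp _), mem_testGraph.2 ⟨φ n, h3.coeFn_toLp, h4.coeFn_toLp⟩, ?_⟩
  rw [dist_comm, Prod.dist_eq, max_lt_iff]
  constructor
  · rw [Lp.dist_def]
    refine ENNReal.toReal_lt_of_lt_ofReal ?_
    rwa [eLpNorm_congr_ae (h3.coeFn_toLp.sub hf.coeFn_toLp)]
  · rw [Lp.dist_def]
    refine ENNReal.toReal_lt_of_lt_ofReal ?_
    rwa [eLpNorm_congr_ae (h4.coeFn_toLp.sub hY.coeFn_toLp)]

namespace Pairs

variable {f g : ℝ × ℝ → ℝ} {Y Z : Dist → ℝ}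

lemma memLp_fst (h : Pairs ν f Y) : MemLp f 2 volume := by
  obtain ⟨z, -, h1, -⟩ := h
  exact (Lp.memLp z.1).ae_eq h1

lemma memLp_snd (h : Pairs ν f Y) : MemLp Y 2 ν := by
  obtain ⟨z, -, -, h1⟩ := h
  exact (Lp.memLp z.2).ae_eq h1

lemma congr (h : Pairs ν f Y) (hf : f =ᵐ[volume] g) (hY : Y =ᵐ[ν] Z) : Pairs ν g Z := by
  obtain ⟨z, hz, h1, h2⟩ := h
  exact ⟨z, hz, h1.trans hf, h2.trans hY⟩

lemma zero : Pairs ν 0 0 := ⟨0, zero_mem _, Lp.coeFn_zero _ _ _, Lp.coeFn_zero _ _ _⟩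

lemma add (h : Pairs ν f Y) (h' : Pairs ν g Z) : Pairs ν (f + g) (Y + Z) := by
  obtain ⟨z, hz, h1, h2⟩ := h
  obtain ⟨w, hw, h3, h4⟩ := h'
  exact ⟨z + w, add_mem hz hw, (Lp.coeFn_add _ _).trans (h1.add h3),
    (Lp.coeFn_add _ _).trans (h2.add h4)⟩

lemma smul (r : ℝ) (h : Pairs ν f Y) : Pairs ν (r • f) (r • Y) := by
  obtain ⟨z, hz, h1, h2⟩ := h
  exact ⟨r • z, Submodule.smul_mem _ r hz, (Lp.coeFn_smul _ _).trans (h1.const_smul r),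
    (Lp.coeFn_smul _ _).trans (h2.const_smul r)⟩

lemma sub (h : Pairs ν f Y) (h' : Pairs ν g Z) : Pairs ν (f - g) (Y - Z) := by
  have := h.add (h'.smul (-1))
  simpa [sub_eq_add_neg] using this

lemma sum {ι : Type*} (s : Finset ι) {f : ι → ℝ × ℝ → ℝ} {Y : ι → Dist → ℝ}
    (h : ∀ i ∈ s, Pairs ν (f i) (Y i)) : Pairs ν (∑ i ∈ s, f i) (∑ i ∈ s, Y i) := by
  classical
  induction s using Finset.induction_on with
  | empty => simpa using zero
  | insert a s ha ih =>
    rw [Finset.sum_insert ha, Finset.sum_insert ha]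
    exact (h a (by simp)).add (ih fun i hi => h i (by simp [hi]))

end Pairs

lemma continuous_integral_cexp [IsProbabilityMeasure ν] :
    Continuous fun Y : Lp ℝ 2 ν => ∫ ω, Complex.exp (Complex.I * (Y ω : ℂ)) ∂ν := by
  have hint : ∀ Y : Lp ℝ 2 ν, Integrable (fun ω => Complex.exp (Complex.I * (Y ω : ℂ))) ν := by
    intro Y
    simpa using integrable_cexp_I_mul (Lp.aestronglyMeasurable Y) 1
  refine LipschitzWith.continuous (K := 1) (LipschitzWith.of_dist_le_mul fun Y Z => ?_)
  have hL : MemLp (fun ω => Y ω - Z ω) 2 ν := (Lp.memLp Y).sub (Lp.memLp Z)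
  have hL1 : MemLp (fun ω => Y ω - Z ω) 1 ν := hL.mono_exponent one_le_two
  rw [dist_eq_norm, ← integral_sub (hint Y) (hint Z), NNReal.coe_one, one_mul]
  refine (norm_integral_le_of_norm_le (g := fun ω => ‖Y ω - Z ω‖)
    (hL1.integrable le_rfl).norm (Eventually.of_forall fun ω => ?_)).trans ?_
  · refine (norm_exp_I_mul_sub_exp_I_mul_le (by simp) (by simp)).trans (le_of_eq ?_)
    rw [← Complex.ofReal_sub, Complex.norm_real]
  · rw [integral_norm_eq_lintegral_enorm hL.1, ← eLpNorm_one_eq_lintegral_enorm, Lp.dist_def]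
    refine ENNReal.toReal_mono ?_ ?_
    · exact ((Lp.memLp Y).sub (Lp.memLp Z)).2.ne
    · exact eLpNorm_le_eLpNorm_of_exponent_le one_le_two hL.1

variable [IsProbabilityMeasure ν]

/-- The characteristic function of a value of the extended noise. -/
lemma Pairs.charFun_one (hσ : IntegrableOn (fun τ : ℝ => τ ^ 2) (Ioi 0) σ)
    (hν : IsCenteredLevyNoise σ ν) {f : ℝ × ℝ → ℝ} {Y : Dist → ℝ} (h : Pairs ν f Y) :
    ∫ ω, Complex.exp (Complex.I * (Y ω : ℂ)) ∂ν =
      Complex.exp (levyExponent (jumpMeasure σ) (jumpOf f) 1) := by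
  have := sigmaFinite_restrict_Ioi hσ
  obtain ⟨z, hz, h1, h2⟩ := h
  have hclosed : IsClosed {z : Lp ℝ 2 (volume : Measure (ℝ × ℝ)) × Lp ℝ 2 ν |
      ∫ ω, Complex.exp (Complex.I * (z.2 ω : ℂ)) ∂ν =
        Complex.exp (levyExponent (jumpMeasure σ) (jumpOf z.1) 1)} :=
    isClosed_eq (continuous_integral_cexp.comp continuous_snd)
      (Complex.continuous_exp.comp ((continuous_levyExponent_jumpOf hσ).comp continuous_fst))
  have hsub : ((testGraph ν : Set (Lp ℝ 2 (volume : Measure (ℝ × ℝ)) × Lp ℝ 2 ν))) ⊆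
      {z | ∫ ω, Complex.exp (Complex.I * (z.2 ω : ℂ)) ∂ν =
        Complex.exp (levyExponent (jumpMeasure σ) (jumpOf z.1) 1)} := by
    intro z hz
    obtain ⟨φ, h1, h2⟩ := mem_testGraph.1 hz
    have e1 : ∫ ω, Complex.exp (Complex.I * (z.2 ω : ℂ)) ∂ν =
        ∫ ω : Dist, Complex.exp (Complex.I * ((ω φ : ℝ) : ℂ)) ∂ν := by
      refine integral_congr_ae ?_
      filter_upwards [h2] with ω hω
      rw [hω]
    have hφ : MemLp (jumpOf φ) 2 (jumpMeasure σ) :=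
      memLp_jumpOf hσ ((Lp.memLp z.1).ae_eq h1)
    simp only [mem_ofPred_eq]
    rw [e1, hν φ, levyExponent_congr (jumpOf_congr hσ h1), levyExponent, jumpMeasure,
      integral_prod _ (integrable_compExp hφ (by simp))]
    simp only [one_mul, jumpOf, compExp]
  have h3 := closure_minimal hsub hclosed hz
  simp only [mem_ofPred_eq] at h3
  rw [levyExponent_congr (jumpOf_congr hσ h1)] at h3
  rw [← h3]
  refine integral_congr_ae ?_
  filter_upwards [h2] with ω hω
  rw [hω]

lemma Pairs.charFun (hσ : IntegrableOn (fun τ : ℝ => τ ^ 2) (Ioi 0) σ)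
    (hν : IsCenteredLevyNoise σ ν) {f : ℝ × ℝ → ℝ} {Y : Dist → ℝ} (h : Pairs ν f Y) (r : ℝ) :
    ∫ ω, Complex.exp (Complex.I * ((r : ℂ) * (Y ω : ℂ))) ∂ν =
      Complex.exp (levyExponent (jumpMeasure σ) (jumpOf f) r) := by
  have := (h.smul r).charFun_one hσ hν
  rw [jumpOf_smul] at this
  simpa [levyExponent] using this

lemma Pairs.toReal_eLpNorm_sq_le (hσ : IntegrableOn (fun τ : ℝ => τ ^ 2) (Ioi 0) σ)
    (hν : IsCenteredLevyNoise σ ν) {f : ℝ × ℝ → ℝ} {Y : Dist → ℝ} (h : Pairs ν f Y) :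
    (eLpNorm Y 2 ν).toReal ^ 2 ≤
      2 * (secondMoment σ * (eLpNorm f 2 volume).toReal ^ 2) := by
  have h1 := lintegral_sq_le_of_charFun h.memLp_snd.1 (memLp_jumpOf hσ h.memLp_fst)
    (h.charFun hσ hν)
  rw [← ofReal_integral_eq_lintegral_ofReal h.memLp_snd.integrable_sq
    (Eventually.of_forall fun ω => sq_nonneg _), integral_jumpOf_sq hσ,
    ENNReal.ofReal_le_ofReal_iff] at h1
  · rwa [toReal_eLpNorm_two_sq h.memLp_snd, toReal_eLpNorm_two_sq h.memLp_fst]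
  · exact mul_nonneg zero_le_two (mul_nonneg (integral_nonneg fun _ => sq_nonneg _)
      (integral_nonneg fun _ => sq_nonneg _))

lemma Pairs.integral_exp_neg (hσ : IntegrableOn (fun τ : ℝ => τ ^ 2) (Ioi 0) σ)
    (hν : IsCenteredLevyNoise σ ν) {f : ℝ × ℝ → ℝ} {Y : Dist → ℝ} (h : Pairs ν f Y)
    (hf : ∀ᵐ p, 0 ≤ f p) :
    Integrable (fun ω => Real.exp (-Y ω)) ν ∧ ∫ ω, Real.exp (-Y ω) ∂ν =
      Real.exp (∫ q, (Real.exp (-jumpOf f q) - 1 + jumpOf f q) ∂jumpMeasure σ) := by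
  have := sigmaFinite_restrict_Ioi hσ
  refine integral_exp_neg_of_charFun h.memLp_snd.1 (memLp_jumpOf hσ h.memLp_fst) ?_
    (h.charFun hσ hν)
  have h1 := (Measure.quasiMeasurePreserving_fst (μ := (volume : Measure (ℝ × ℝ)))
    (ν := σ.restrict (Ioi 0))).ae hf
  filter_upwards [ae_jumpMeasure_pos hσ, h1] with q hq hq'
  exact mul_nonneg hq.le hq'

/-- Pairings may be integrated over a parameter. The `L²` bound turns continuity of `u ↦ f u` into
continuity of `u ↦ Y u`, so that the pair is integrated in the closed graph. -/
lemma Pairs.intervalIntegral (hσ : IntegrableOn (fun τ : ℝ => τ ^ 2) (Ioi 0) σ)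
    (hν : IsCenteredLevyNoise σ ν) {f : ℝ → ℝ × ℝ → ℝ} {Y : ℝ → Dist → ℝ}
    (h : ∀ u, Pairs ν (f u) (Y u)) (hf : Measurable (Function.uncurry f))
    (hY : Measurable (Function.uncurry Y))
    (hcont : ∀ u₀, Tendsto (fun u => eLpNorm (fun p => f u p - f u₀ p) 2 volume) (𝓝 u₀) (𝓝 0))
    {a b : ℝ} (hab : a ≤ b) :
    Pairs ν (fun p => ∫ u in a..b, f u p) (fun ω => ∫ u in a..b, Y u ω) ∧
      (∀ᵐ ω ∂ν, IntervalIntegrable (fun u => Y u ω) volume a b) ∧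
      ∀ m : MeasurableSpace Dist, m ≤ cylinder → (∀ u, AEStronglyMeasurable[m] (Y u) ν) →
        AEStronglyMeasurable[m] (fun ω => ∫ u in a..b, Y u ω) ν := by
  choose z hz h1 h2 using h
  have hz1 : Continuous fun u => (z u).1 := by
    refine continuous_iff_continuousAt.2 fun u₀ => tendsto_iff_dist_tendsto_zero.2 ?_
    have h3 : ∀ u, dist (z u).1 (z u₀).1 =
        (eLpNorm (fun p => f u p - f u₀ p) 2 volume).toReal := fun u => by
      rw [Lp.dist_def, eLpNorm_congr_ae ((h1 u).sub (h1 u₀))]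
      rfl
    simp_rw [h3]
    exact (ENNReal.tendsto_toReal ENNReal.zero_ne_top).comp (hcont u₀)
  have hz2 : Continuous fun u => (z u).2 := by
    refine continuous_iff_continuousAt.2 fun u₀ => tendsto_iff_norm_sub_tendsto_zero.2 ?_
    have h3 : ∀ u, ‖(z u).2 - (z u₀).2‖ ≤
        Real.sqrt (2 * secondMoment σ) * ‖(z u).1 - (z u₀).1‖ := by
      intro u
      have hc : 0 ≤ 2 * secondMoment σ :=
        mul_nonneg zero_le_two (integral_nonneg fun _ => sq_nonneg _)
      have h4 : Pairs ν ((z u).1 - (z u₀).1 : Lp ℝ 2 _) ((z u).2 - (z u₀).2 : Lp ℝ 2 _) :=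
        ⟨z u - z u₀, sub_mem (hz u) (hz u₀), EventuallyEq.rfl, EventuallyEq.rfl⟩
      have h5 := h4.toReal_eLpNorm_sq_le hσ hν
      rw [← Lp.norm_def, ← Lp.norm_def, ← mul_assoc] at h5
      rw [← abs_of_nonneg (norm_nonneg ((z u).2 - (z u₀).2))]
      refine abs_le_of_sq_le_sq ?_ (by positivity)
      rwa [mul_pow, Real.sq_sqrt hc]
    refine squeeze_zero (fun u => norm_nonneg _) h3 ?_
    have h6 := (tendsto_iff_norm_sub_tendsto_zero.1 (hz1.tendsto u₀)).const_mul
      (Real.sqrt (2 * secondMoment σ))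
    simpa using h6
  have hzc : Continuous z := hz1.prodMk hz2
  have hi1 : (∫ u in a..b, z u).1 = ∫ u in a..b, (z u).1 :=
    ((ContinuousLinearMap.fst ℝ _ _).intervalIntegral_comp_comm
      (hzc.intervalIntegrable a b)).symm
  have hi2 : (∫ u in a..b, z u).2 = ∫ u in a..b, (z u).2 :=
    ((ContinuousLinearMap.snd ℝ _ _).intervalIntegral_comp_comm
      (hzc.intervalIntegrable a b)).symm
  have hY2 := coeFn_intervalIntegral_Lp hz2 hY h2 hab
  refine ⟨⟨∫ u in a..b, z u, ?_, ?_, ?_⟩, ?_, ?_⟩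
  · exact intervalIntegral_mem_of_isClosed (Submodule.isClosed_topologicalClosure _) hzc hz a b
  · rw [hi1]
    exact coeFn_intervalIntegral_Lp hz1 hf h1 hab
  · rw [hi2]
    exact hY2
  · exact ae_intervalIntegrable_of_continuous_Lp hz2 hY h2 hab
  · intro m hm hYm
    exact (aestronglyMeasurable_intervalIntegral_Lp hm hz2
      (fun u => (hYm u).congr (h2 u).symm) a b).congr hY2

end Graph

/-! ### Independence and the information σ-algebras -/

section Independence

variable {σ : Measure ℝ} {ν : Measure Dist} [IsProbabilityMeasure ν]

lemma Pairs.integral_cexp_add (hσ : IntegrableOn (fun τ : ℝ => τ ^ 2) (Ioi 0) σ)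
    (hν : IsCenteredLevyNoise σ ν) {f g : ℝ × ℝ → ℝ} {Y W : Dist → ℝ} (hf : Pairs ν f Y)
    (hg : Pairs ν g W) (hfg : ∀ᵐ p, f p * g p = 0) :
    ∫ ω, Complex.exp (Complex.I * ((Y ω + W ω : ℝ) : ℂ)) ∂ν =
      (∫ ω, Complex.exp (Complex.I * (Y ω : ℂ)) ∂ν) *
        ∫ ω, Complex.exp (Complex.I * (W ω : ℂ)) ∂ν := by
  have := sigmaFinite_restrict_Ioi hσ
  have h1 := (hf.add hg).charFun_one hσ hν
  simp only [Pi.add_apply] at h1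
  have h2 : jumpOf (f + g) = fun q => jumpOf f q + jumpOf g q := by
    ext q; simp only [jumpOf, Pi.add_apply]; ring
  have h3 := (Measure.quasiMeasurePreserving_fst (μ := (volume : Measure (ℝ × ℝ)))
    (ν := σ.restrict (Ioi 0))).ae hfg
  rw [h1, hf.charFun_one hσ hν, hg.charFun_one hσ hν, ← Complex.exp_add, h2,
    levyExponent_add_of_mul_eq_zero (memLp_jumpOf hσ hf.memLp_fst) (memLp_jumpOf hσ hg.memLp_fst)]
  filter_upwards [h3] with q hq
  simp only [jumpOf]
  linear_combination q.2 * q.2 * hq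

/-- The noise is independently scattered: the value at `g` is independent of the values at any
family of functions with supports disjoint from that of `g`. -/
lemma indepFun_of_pairs (hσ : IntegrableOn (fun τ : ℝ => τ ^ 2) (Ioi 0) σ)
    (hν : IsCenteredLevyNoise σ ν) {ι : Type*} {f : ι → ℝ × ℝ → ℝ} {g : ℝ × ℝ → ℝ}
    {Y : ι → Dist → ℝ} {W : Dist → ℝ} (hYm : ∀ i, Measurable (Y i)) (hWm : Measurable W)
    (hf : ∀ i, Pairs ν (f i) (Y i)) (hg : Pairs ν g W) (hfg : ∀ i, ∀ᵐ p, f i p * g p = 0) :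
    IndepFun (fun ω i => Y i ω) W ν := by
  classical
  refine IndepFun.process_indepFun hYm hWm fun I => ?_
  have hYI : Measurable fun ω (i : I) => Y i ω := measurable_pi_lambda _ fun i => hYm i
  rw [indepFun_iff_charFunDual_prod hYI.aemeasurable hWm.aemeasurable]
  intro L
  have hL1 : ∀ v : I → ℝ, L (v, 0) = ∑ i, v i * L (Pi.single i 1, 0) := by
    intro v
    have : (v, (0 : ℝ)) = ∑ i, v i • ((Pi.single i (1 : ℝ) : I → ℝ), (0 : ℝ)) := by
      refine Prod.ext ?_ ?_
      · rw [Prod.fst_sum]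
        simp only [Prod.smul_fst]
        exact pi_eq_sum_univ' v
      · rw [Prod.snd_sum]; simp
    rw [this, map_sum]
    exact Finset.sum_congr rfl fun i _ => by rw [map_smul, smul_eq_mul]
  have hL2 : ∀ w : ℝ, L (0, w) = w * L (0, 1) := by
    intro w
    have : ((0 : I → ℝ), w) = w • ((0 : I → ℝ), (1 : ℝ)) := by simp
    rw [this, map_smul, smul_eq_mul]
  have hL : ∀ (v : I → ℝ) (w : ℝ), L (v, w) = L (v, 0) + L (0, w) := by
    intro v w
    rw [← map_add]; simp
  have hA : Pairs ν (∑ i : I, L (Pi.single i 1, 0) • f i) (∑ i : I, L (Pi.single i 1, 0) • Y i) :=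
    Pairs.sum _ fun i _ => (hf i).smul _
  have hB : Pairs ν (L (0, 1) • g) (L (0, 1) • W) := hg.smul _
  have hAB : ∀ᵐ p, (∑ i : I, L (Pi.single i 1, 0) • f i) p * (L (0, 1) • g) p = 0 := by
    filter_upwards [ae_all_iff.2 fun i : I => hfg i] with p hp
    simp only [Finset.sum_apply, Pi.smul_apply, smul_eq_mul, Finset.sum_mul]
    refine Finset.sum_eq_zero fun i _ => ?_
    linear_combination L (Pi.single i 1, 0) * L (0, 1) * hp i
  have key := hA.integral_cexp_add hσ hν hB hAB
  have e1 : ∀ ω, (∑ i : I, L (Pi.single i 1, 0) • Y i) ω = L (fun i => Y i ω, 0) := by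
    intro ω
    rw [hL1]
    simp [Finset.sum_apply, mul_comm]
  have e2 : ∀ ω, (L (0, 1) • W) ω = L (0, W ω) := by
    intro ω
    rw [hL2 (W ω)]
    exact mul_comm _ _
  simp_rw [e1, e2, ← hL] at key
  have hsnd : charFunDual (ν.map W) (L.comp (.inr ℝ (I → ℝ) ℝ)) =
      ∫ ω, Complex.exp (Complex.I * ((L (0, W ω) : ℝ) : ℂ)) ∂ν := by
    rw [charFunDual_apply, integral_map hWm.aemeasurable]
    · simp_rw [mul_comm Complex.I]
      rfl
    · exact (by fun_prop : Continuous fun v : ℝ =>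
        Complex.exp ((L.comp (.inr ℝ (I → ℝ) ℝ) v : ℂ) * Complex.I)).aestronglyMeasurable
  have hpi : charFunDual (ν.map fun ω (i : I) => Y i ω) (L.comp (.inl ℝ (I → ℝ) ℝ)) =
      ∫ ω, Complex.exp (Complex.I * ((L (fun i : I => Y i ω, 0) : ℝ) : ℂ)) ∂ν := by
    rw [charFunDual_apply, integral_map hYI.aemeasurable]
    · simp_rw [mul_comm Complex.I]
      rfl
    · exact (by fun_prop : Continuous fun v : I → ℝ =>
        Complex.exp ((L.comp (.inl ℝ (I → ℝ) ℝ) v : ℂ) * Complex.I)).aestronglyMeasurable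
  have hprod : charFunDual (ν.map fun ω => ((fun i : I => Y i ω), W ω)) L =
      ∫ ω, Complex.exp (Complex.I * ((L (fun i : I => Y i ω, W ω) : ℝ) : ℂ)) ∂ν := by
    rw [charFunDual_apply, integral_map (hYI.prodMk hWm).aemeasurable]
    · simp_rw [mul_comm Complex.I]
    · exact (by fun_prop : Continuous fun v : (I → ℝ) × ℝ =>
        Complex.exp ((L v : ℂ) * Complex.I)).aestronglyMeasurable
  rw [hprod, hpi, hsnd, key]

end Independence

section Info

variable {ν : Measure Dist}

lemma rawInfo_le {F : ℝ → ℝ → Dist → ℝ} (hF : ∀ u v, Measurable (F u v)) (s : ℝ) :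
    rawInfo F s ≤ cylinder :=
  iSup₂_le fun u _ => iSup₂_le fun v _ => (hF u v).comap_le

lemma measurable_rawInfo {F : ℝ → ℝ → Dist → ℝ} {s u v : ℝ} (hu : u ∈ Icc 0 s) (huv : u ≤ v) :
    Measurable[rawInfo F s] (F u v) := by
  have h : (borel ℝ).comap (F u v) ≤ rawInfo F s :=
    le_iSup₂_of_le u hu (le_iSup₂_of_le v huv le_rfl)
  exact measurable_iff_comap_le.2 h

/-- A random variable with an a.e. equal version measurable for the raw information is measurable
for the information. -/
lemma measurable_info {F : ℝ → ℝ → Dist → ℝ} {s : ℝ} {f : Dist → ℝ} (hf : Measurable f)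
    (hf' : AEStronglyMeasurable[rawInfo F s] f ν) : Measurable[info ν F s] f := by
  obtain ⟨g, hg, hfg⟩ := hf'
  have h1 : EventuallyMeasurable (rawInfo F s) (ae ν) f :=
    @Measurable.eventuallyMeasurable_of_eventuallyEq _ (rawInfo F s) (ae ν) _ _ _ g f
      hg.measurable hfg
  intro B hB
  exact ⟨h1 hB, hf hB⟩

/-- Completion by null sets preserves independence. -/
lemma indep_info {F : ℝ → ℝ → Dist → ℝ} {s : ℝ} {m : MeasurableSpace Dist}
    (h : Indep m (rawInfo F s) ν) : Indep m (info ν F s) ν := by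
  rw [Indep_iff] at h ⊢
  rintro A B hA ⟨⟨B', hB', hBB'⟩, -⟩
  have h1 : (A ∩ B : Set Dist) =ᵐ[ν] (A ∩ B' : Set Dist) := ae_eq_set_inter (ae_eq_refl _) hBB'
  rw [measure_congr h1, measure_congr hBB', h A B' hA hB']

end Info

/-! ### The kernels of the field and of the log-price -/

section Kernel

variable {ϰ : ℝ × ℝ → ℝ}

/-- The integrand of the log-price: `-∫_s^t X_{s,u} du - ∫_0^s X_{u,u} du` is minus the value of the
noise at this function. -/
def priceKernel (ϰ : ℝ × ℝ → ℝ) (s t : ℝ) (p : ℝ × ℝ) : ℝ :=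
  if 0 ≤ p.1 ∧ p.1 ≤ s ∧ 0 ≤ p.2 then ϰ p * max (t - max p.1 p.2) 0 else 0

lemma integral_ite_le (k c : ℝ) {a b : ℝ} (hab : a ≤ b) :
    ∫ u in a..b, (if c ≤ u then k else 0) = k * max (b - max a c) 0 := by
  rw [intervalIntegral.integral_of_le hab]
  have h1 : (fun u : ℝ => if c ≤ u then k else 0) = (Ici c).indicator fun _ => k := by
    ext u; simp [indicator, mem_Ici]
  rw [h1, setIntegral_indicator measurableSet_Ici]
  have h2 : (Ioc a b ∩ Ici c : Set ℝ) =ᵐ[volume] Ioc (max a c) b := by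
    have h3 : (Ici c : Set ℝ) =ᵐ[volume] Ioi c := Ioi_ae_eq_Ici.symm
    refine (ae_eq_set_inter (ae_eq_refl _) h3).trans (Eventually.of_forall fun u => ?_)
    refine propext ⟨fun h => ⟨max_lt h.1.1 h.2, h.1.2⟩, fun h => ⟨⟨(le_max_left _ _).trans_lt h.1,
      h.2⟩, (le_max_right a c).trans_lt h.1⟩⟩
  rw [setIntegral_congr_set h2, setIntegral_const, smul_eq_mul, mul_comm]
  simp [Measure.real, Real.volume_Ioc, ENNReal.toReal_ofReal']

lemma measurable_indicator_box (hϰ : Measurable ϰ) {a b : ℝ → ℝ} (ha : Measurable a)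
    (hb : Measurable b) : Measurable (Function.uncurry fun (u : ℝ) (p : ℝ × ℝ) =>
      (Icc 0 (a u) ×ˢ Icc 0 (b u)).indicator ϰ p) := by
  have hS : MeasurableSet {q : ℝ × (ℝ × ℝ) |
      (0 ≤ q.2.1 ∧ q.2.1 ≤ a q.1) ∧ 0 ≤ q.2.2 ∧ q.2.2 ≤ b q.1} := by
    exact ((measurableSet_le measurable_const measurable_snd.fst).inter
      (measurableSet_le measurable_snd.fst (ha.comp measurable_fst))).inter
      ((measurableSet_le measurable_const measurable_snd.snd).inter
      (measurableSet_le measurable_snd.snd (hb.comp measurable_fst)))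
  exact (hϰ.comp measurable_snd).indicator hS

/-- Boxes depend continuously on their corner, in `L²` of a locally bounded density: their
indicators converge off two lines. -/
lemma tendsto_eLpNorm_indicator_box (hϰ : Measurable ϰ)
    (hϰ_bdd : ∀ T : ℝ, BddAbove (ϰ '' (Icc 0 T ×ˢ Icc 0 T)))
    (hϰ_nonneg : ∀ x y : ℝ, 0 ≤ x → 0 ≤ y → 0 ≤ ϰ (x, y)) {a b : ℝ → ℝ} (ha : Continuous a)
    (hb : Continuous b)
    (hmem : ∀ u, MemLp ((Icc 0 (a u) ×ˢ Icc 0 (b u)).indicator ϰ) 2 volume) (u₀ : ℝ) :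
    Tendsto (fun u => eLpNorm (fun p => (Icc 0 (a u) ×ˢ Icc 0 (b u)).indicator ϰ p -
      (Icc 0 (a u₀) ×ˢ Icc 0 (b u₀)).indicator ϰ p) 2 volume) (𝓝 u₀) (𝓝 0) := by
  set f : ℝ → ℝ × ℝ → ℝ := fun u => (Icc 0 (a u) ×ˢ Icc 0 (b u)).indicator ϰ with hfdef
  set T : ℝ := max (a u₀) (b u₀) + 1 with hT
  obtain ⟨C, hC⟩ := hϰ_bdd T
  have hbound : ∀ u, a u ≤ T → b u ≤ T → ∀ p,
      |f u p| ≤ (Icc 0 T ×ˢ Icc 0 T).indicator (fun _ => |C|) p := by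
    intro u hau hbu p
    by_cases hp : p ∈ Icc 0 (a u) ×ˢ Icc 0 (b u)
    · have hp' : p ∈ Icc 0 T ×ˢ Icc 0 T :=
        ⟨⟨hp.1.1, hp.1.2.trans hau⟩, ⟨hp.2.1, hp.2.2.trans hbu⟩⟩
      rw [hfdef]
      simp only [indicator_of_mem hp, indicator_of_mem hp']
      rw [abs_of_nonneg (hϰ_nonneg p.1 p.2 hp.1.1 hp.2.1)]
      exact (hC ⟨p, hp', rfl⟩).trans (le_abs_self C)
    · rw [hfdef]
      simp only [indicator_of_notMem hp, abs_zero]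
      exact indicator_nonneg (fun _ _ => abs_nonneg C) p
  have hfm : ∀ u, Measurable (f u) := fun u =>
    hϰ.indicator (measurableSet_Icc.prod measurableSet_Icc)
  have hsq : Tendsto (fun u => ∫ p, (f u p - f u₀ p) ^ 2) (𝓝 u₀) (𝓝 0) := by
    have h0 : (0 : ℝ) = ∫ _ : ℝ × ℝ, (0 : ℝ) := by simp
    rw [h0]
    refine tendsto_integral_filter_of_dominated_convergence
      ((Icc 0 T ×ˢ Icc 0 T).indicator fun _ => (2 * |C|) ^ 2) ?_ ?_ ?_ ?_
    · exact Eventually.of_forall fun u =>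
        (((hfm u).sub (hfm u₀)).pow_const 2).aestronglyMeasurable
    · have h1 : ∀ᶠ u in 𝓝 u₀, a u < T :=
        ha.continuousAt.eventually_lt continuousAt_const
          (lt_of_le_of_lt (le_max_left _ _) (lt_add_one _))
      have h2 : ∀ᶠ u in 𝓝 u₀, b u < T :=
        hb.continuousAt.eventually_lt continuousAt_const
          (lt_of_le_of_lt (le_max_right _ _) (lt_add_one _))
      filter_upwards [h1, h2] with u hu1 hu2
      refine Eventually.of_forall fun p => ?_
      have h3 := hbound u hu1.le hu2.le p
      have h4 := hbound u₀ h1.self_of_nhds.le h2.self_of_nhds.le p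
      rw [Real.norm_eq_abs, abs_of_nonneg (sq_nonneg _)]
      by_cases hp : p ∈ Icc 0 T ×ˢ Icc 0 T
      · simp only [indicator_of_mem hp] at h3 h4 ⊢
        refine sq_le_sq' ?_ ?_ <;> linarith [abs_le.1 h3, abs_le.1 h4, (abs_le.1 h3).1,
          (abs_le.1 h3).2, (abs_le.1 h4).1, (abs_le.1 h4).2]
      · simp only [indicator_of_notMem hp] at h3 h4 ⊢
        rw [abs_nonpos_iff.1 h3, abs_nonpos_iff.1 h4]
        simp
    · refine (integrable_indicator_iff (measurableSet_Icc.prod measurableSet_Icc)).2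
        (integrableOn_const ?_)
      exact (isCompact_Icc.prod isCompact_Icc).measure_lt_top.ne
    · have h1 : ∀ᵐ p : ℝ × ℝ, p.1 ≠ a u₀ :=
        (Measure.quasiMeasurePreserving_fst (μ := (volume : Measure ℝ))
          (ν := (volume : Measure ℝ))).ae (Measure.ae_ne volume (a u₀))
      have h2 : ∀ᵐ p : ℝ × ℝ, p.2 ≠ b u₀ :=
        (Measure.quasiMeasurePreserving_snd (μ := (volume : Measure ℝ))
          (ν := (volume : Measure ℝ))).ae (Measure.ae_ne volume (b u₀))
      filter_upwards [h1, h2] with p hp1 hp2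
      have aux : ∀ {c : ℝ → ℝ}, Continuous c → ∀ {r : ℝ}, r ≠ c u₀ →
          ∀ᶠ u in 𝓝 u₀, (r ≤ c u ↔ r ≤ c u₀) := by
        intro c hc r hr
        rcases lt_or_gt_of_ne hr with h | h
        · filter_upwards [continuousAt_const.eventually_lt hc.continuousAt h] with u hu
          exact ⟨fun _ => h.le, fun _ => hu.le⟩
        · filter_upwards [hc.continuousAt.eventually_lt continuousAt_const h] with u hu
          exact ⟨fun h' => absurd h' (not_le.2 hu), fun h' => absurd h' (not_le.2 h)⟩
      refine tendsto_const_nhds.congr' ?_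
      filter_upwards [aux ha hp1, aux hb hp2] with u hu1 hu2
      have : f u p = f u₀ p := by
        change (Icc 0 (a u) ×ˢ Icc 0 (b u)).indicator ϰ p =
          (Icc 0 (a u₀) ×ˢ Icc 0 (b u₀)).indicator ϰ p
        simp only [indicator, mem_prod, mem_Icc, hu1, hu2]
      simp [this]
  have hval : ∀ u, eLpNorm (fun p => f u p - f u₀ p) 2 volume =
      ENNReal.ofReal (Real.sqrt (∫ p, (f u p - f u₀ p) ^ 2)) := by
    intro u
    have h1 : MemLp (fun p => f u p - f u₀ p) 2 volume := (hmem u).sub (hmem u₀)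
    rw [← toReal_eLpNorm_two_sq h1, Real.sqrt_sq ENNReal.toReal_nonneg,
      ENNReal.ofReal_toReal h1.2.ne]
  refine Tendsto.congr (fun u => (hval u).symm) ?_
  have h2 := (Real.continuous_sqrt.tendsto 0).comp hsq
  rw [Real.sqrt_zero] at h2
  simpa using ENNReal.tendsto_ofReal h2

lemma priceKernel_nonneg (hϰ_nonneg : ∀ x y : ℝ, 0 ≤ x → 0 ≤ y → 0 ≤ ϰ (x, y)) (s t : ℝ)
    (p : ℝ × ℝ) : 0 ≤ priceKernel ϰ s t p := by
  unfold priceKernel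
  split_ifs with h
  · exact mul_nonneg (hϰ_nonneg p.1 p.2 h.1 h.2.2) (le_max_right _ _)
  · exact le_rfl

lemma integral_box_add_integral_box {s t : ℝ} (hs : 0 ≤ s) (hst : s ≤ t) (p : ℝ × ℝ) :
    (∫ u in s..t, (Icc 0 s ×ˢ Icc 0 u).indicator ϰ p) +
      (∫ u in (0 : ℝ)..s, (Icc 0 u ×ˢ Icc 0 u).indicator ϰ p) = priceKernel ϰ s t p := by
  obtain ⟨x, y⟩ := p
  have h1 : ∀ u, (Icc 0 s ×ˢ Icc 0 u).indicator ϰ (x, y) =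
      if y ≤ u then (if 0 ≤ x ∧ x ≤ s ∧ 0 ≤ y then ϰ (x, y) else 0) else 0 := by
    intro u
    simp only [indicator, mem_prod, mem_Icc]
    split_ifs <;> tauto
  have h2 : ∀ u, (Icc 0 u ×ˢ Icc 0 u).indicator ϰ (x, y) =
      if max x y ≤ u then (if 0 ≤ x ∧ 0 ≤ y then ϰ (x, y) else 0) else 0 := by
    intro u
    simp only [indicator, mem_prod, mem_Icc, max_le_iff]
    split_ifs <;> tauto
  simp_rw [h1, h2]
  rw [integral_ite_le _ _ hst, integral_ite_le _ _ hs]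
  simp only [priceKernel]
  by_cases hx : 0 ≤ x ∧ 0 ≤ y
  · have h0 : max 0 (max x y) = max x y := max_eq_right (hx.1.trans (le_max_left _ _))
    by_cases hxs : x ≤ s
    · simp only [hx, hxs, and_self, if_true, h0]
      rw [← mul_add]
      congr 1
      rcases le_total y s with hys | hys
      · have h3 : max x y ≤ s := max_le hxs hys
        rw [max_eq_left hys, max_eq_left (by linarith : 0 ≤ t - s),
          max_eq_left (by linarith : 0 ≤ s - max x y),
          max_eq_left (by linarith : 0 ≤ t - max x y)]
        ring
      · rw [max_eq_right hys, max_eq_right (hxs.trans hys),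
          max_eq_right (by linarith : s - y ≤ 0), add_zero]
    · have h3 : s - max x y ≤ 0 := by
        have := le_max_left x y
        linarith [not_le.1 hxs]
      simp [hxs, h0, max_eq_right h3]
  · have h3 : ¬ (0 ≤ x ∧ x ≤ s ∧ 0 ≤ y) := fun h => hx ⟨h.1, h.2.2⟩
    simp [hx, h3]

end Kernel

section Field

variable {σ : Measure ℝ} {ν : Measure Dist} {ϰ : ℝ × ℝ → ℝ} {X : ℝ → ℝ → Dist → ℝ}

lemma IsLevyField.measurable_eval (hX : IsLevyField ν ϰ X) (s t : ℝ) : Measurable (X s t) :=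
  hX.measurable.comp (measurable_const.prodMk (measurable_const.prodMk measurable_id))

/-- Integrals of the field along a continuous path in the quadrant of its indices. -/
lemma IsLevyField.intervalIntegral_path [IsProbabilityMeasure ν]
    (hσ : IntegrableOn (fun τ : ℝ => τ ^ 2) (Ioi 0) σ)
    (hν : IsCenteredLevyNoise σ ν) (hϰ : Measurable ϰ)
    (hϰ_nonneg : ∀ x y : ℝ, 0 ≤ x → 0 ≤ y → 0 ≤ ϰ (x, y))
    (hϰ_bdd : ∀ T : ℝ, BddAbove (ϰ '' (Icc 0 T ×ˢ Icc 0 T))) (hX : IsLevyField ν ϰ X)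
    {α β : ℝ → ℝ} (hα : Continuous α) (hβ : Continuous β) (hα0 : ∀ u, 0 ≤ α u)
    (hβ0 : ∀ u, 0 ≤ β u) {a b : ℝ} (hab : a ≤ b) :
    Pairs ν (fun p => ∫ u in a..b, (Icc 0 (α u) ×ˢ Icc 0 (β u)).indicator ϰ p)
        (fun ω => ∫ u in a..b, X (α u) (β u) ω) ∧
      (∀ᵐ ω ∂ν, IntervalIntegrable (fun u => X (α u) (β u) ω) volume a b) ∧
      ∀ m : MeasurableSpace Dist, m ≤ cylinder →
        (∀ u, AEStronglyMeasurable[m] (X (α u) (β u)) ν) →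
        AEStronglyMeasurable[m] (fun ω => ∫ u in a..b, X (α u) (β u) ω) ν := by
  have hp : ∀ u, Pairs ν ((Icc 0 (α u) ×ˢ Icc 0 (β u)).indicator ϰ) (X (α u) (β u)) := fun u =>
    (hX.isPairing _ _ (hα0 u) (hβ0 u)).pairs
  have hXm : Measurable (Function.uncurry fun u ω => X (α u) (β u) ω) :=
    hX.measurable.comp ((hα.measurable.comp measurable_fst).prodMk
      ((hβ.measurable.comp measurable_fst).prodMk measurable_snd))
  exact Pairs.intervalIntegral hσ hν (Y := fun u => X (α u) (β u)) hp
    (measurable_indicator_box hϰ hα.measurable hβ.measurable) hXm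
    (tendsto_eLpNorm_indicator_box hϰ hϰ_bdd hϰ_nonneg hα hβ fun u => (hp u).memLp_fst) hab

end Field

/-! ### Discounted bond prices -/

/-- The data of the term structure model: the Lévy noise, the local volatility, the field driving
the forward rates, and their means. -/
structure IsModel (σ : Measure ℝ) (ν : Measure Dist) (ϰ : ℝ × ℝ → ℝ) (X : ℝ → ℝ → Dist → ℝ)
    (μ : ℝ → ℝ → ℝ) : Prop where
  isProb : IsProbabilityMeasure ν
  sq_integrable : IntegrableOn (fun τ : ℝ => τ ^ 2) (Ioi 0) σ
  isNoise : IsCenteredLevyNoise σ ν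
  measurable_vol : Measurable ϰ
  vol_nonneg : ∀ x y : ℝ, 0 ≤ x → 0 ≤ y → 0 ≤ ϰ (x, y)
  vol_bdd : ∀ T : ℝ, BddAbove (ϰ '' (Icc 0 T ×ˢ Icc 0 T))
  isField : IsLevyField ν ϰ X
  continuousOn_mean : ContinuousOn (fun p : ℝ × ℝ => μ p.1 p.2) {p | 0 ≤ p.1 ∧ p.1 ≤ p.2}

/-- The deterministic part `∫_s^t μ_{s,u} du + ∫_0^s μ_{u,u} du` of `-log Z_{s,t}`. -/
def meanExponent (μ : ℝ → ℝ → ℝ) (s t : ℝ) : ℝ :=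
  (∫ u in s..t, μ s u) + ∫ u in (0 : ℝ)..s, μ u u

/-- The random part of `-log Z_{s,t}`. -/
def randomExponent (μ : ℝ → ℝ → ℝ) (X : ℝ → ℝ → Dist → ℝ) (s t : ℝ) (ω : Dist) : ℝ :=
  (∫ u in s..t, forwardRate μ X s u ω) + (∫ u in (0 : ℝ)..s, spotRate (forwardRate μ X) u ω) -
    meanExponent μ s t

lemma discountedBondPrice_eq (μ : ℝ → ℝ → ℝ) (X : ℝ → ℝ → Dist → ℝ) (s t : ℝ) (ω : Dist) :
    discountedBondPrice (forwardRate μ X) s t ω =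
      Real.exp (-meanExponent μ s t) * Real.exp (-randomExponent μ X s t ω) := by
  rw [discountedBondPrice, bondPrice, randomExponent, ← Real.exp_add, ← Real.exp_add]
  congr 1
  ring

/-- The exponent `∫∫∫ (e^{-τ g} - 1 + τ g) σ(dτ) dx dy` of the Laplace transform of the value of the
noise at `g`. -/
def laplaceExponent (σ : Measure ℝ) (g : ℝ × ℝ → ℝ) : ℝ :=
  ∫ q, (Real.exp (-jumpOf g q) - 1 + jumpOf g q) ∂jumpMeasure σ

namespace IsModel

variable {σ : Measure ℝ} {ν : Measure Dist} {ϰ : ℝ × ℝ → ℝ} {X : ℝ → ℝ → Dist → ℝ}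
  {μ : ℝ → ℝ → ℝ} {s t : ℝ}

lemma measurable_forwardRate (h : IsModel σ ν ϰ X μ) (u v : ℝ) :
    Measurable (forwardRate μ X u v) := (h.isField.measurable_eval u v).const_add _

lemma rawInfo_le (h : IsModel σ ν ϰ X μ) (s : ℝ) : rawInfo (forwardRate μ X) s ≤ cylinder :=
  LevyTermStructure.rawInfo_le h.measurable_forwardRate s

lemma measurable_rawInfo_field (X : ℝ → ℝ → Dist → ℝ) (μ : ℝ → ℝ → ℝ) {u v : ℝ}
    (hu : u ∈ Icc 0 s) (huv : u ≤ v) : Measurable[rawInfo (forwardRate μ X) s] (X u v) := by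
  have h1 : Measurable[rawInfo (forwardRate μ X) s] fun ω => forwardRate μ X u v ω - μ u v :=
    Measurable.sub_const (measurable_rawInfo hu huv) _
  have h2 : (fun ω => forwardRate μ X u v ω - μ u v) = X u v := by
    ext ω; simp [forwardRate]
  rwa [h2] at h1

lemma continuous_mean_clip (h : IsModel σ ν ϰ X μ) {α β : ℝ → ℝ} (hα : Continuous α)
    (hβ : Continuous β) (h0 : ∀ u, 0 ≤ α u) (hαβ : ∀ u, α u ≤ β u) :
    Continuous fun u => μ (α u) (β u) :=
  h.continuousOn_mean.comp_continuous (hα.prodMk hβ) fun u => ⟨h0 u, hαβ u⟩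

/-- Integrals of forward rates along a path in the index set `0 ≤ u ≤ v`. -/
lemma integral_path (h : IsModel σ ν ϰ X μ) {α β : ℝ → ℝ} (hα : Continuous α)
    (hβ : Continuous β) (h0 : ∀ u, 0 ≤ α u) (hαβ : ∀ u, α u ≤ β u) {a b : ℝ} (hab : a ≤ b)
    (hs : ∀ u, α u ≤ s) :
    Measurable[info ν (forwardRate μ X) s]
        (fun ω => ∫ u in a..b, forwardRate μ X (α u) (β u) ω) ∧
      (∀ᵐ ω ∂ν, IntervalIntegrable (fun u => forwardRate μ X (α u) (β u) ω) volume a b) ∧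
      Pairs ν (fun p => ∫ u in a..b, (Icc 0 (α u) ×ˢ Icc 0 (β u)).indicator ϰ p)
        (fun ω => (∫ u in a..b, forwardRate μ X (α u) (β u) ω) - ∫ u in a..b, μ (α u) (β u)) := by
  have := h.isProb
  have hμc := h.continuous_mean_clip hα hβ h0 hαβ
  obtain ⟨h1, h2, h3⟩ := h.isField.intervalIntegral_path h.sq_integrable h.isNoise h.measurable_vol
    h.vol_nonneg h.vol_bdd hα hβ h0 (fun u => (h0 u).trans (hαβ u)) hab
  have hsplit : (fun ω => ∫ u in a..b, X (α u) (β u) ω) =ᵐ[ν]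
      fun ω => (∫ u in a..b, forwardRate μ X (α u) (β u) ω) - ∫ u in a..b, μ (α u) (β u) := by
    filter_upwards [h2] with ω hω
    simp only [forwardRate]
    rw [intervalIntegral.integral_add (hμc.intervalIntegrable _ _) hω, add_sub_cancel_left]
  refine ⟨measurable_info ?_ ?_, ?_, h1.congr EventuallyEq.rfl hsplit⟩
  · have hm : Measurable (Function.uncurry fun (ω : Dist) (u : ℝ) =>
        forwardRate μ X (α u) (β u) ω) :=
      (hμc.measurable.comp measurable_snd).add
        (h.isField.measurable.comp ((hα.measurable.comp measurable_snd).prodMk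
          ((hβ.measurable.comp measurable_snd).prodMk measurable_fst)))
    simp only [intervalIntegral.integral_of_le hab]
    exact hm.stronglyMeasurable.integral_prod_right.measurable
  · have h4 := h3 _ (h.rawInfo_le s) fun u =>
      (Measurable.stronglyMeasurable
        (measurable_rawInfo_field X μ ⟨h0 u, hs u⟩ (hαβ u))).aestronglyMeasurable
    have h5 : AEStronglyMeasurable[rawInfo (forwardRate μ X) s]
        (fun ω => (∫ u in a..b, X (α u) (β u) ω) + ∫ u in a..b, μ (α u) (β u)) ν :=
      AEStronglyMeasurable.add h4 aestronglyMeasurable_const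
    refine h5.congr ?_
    filter_upwards [hsplit] with ω hω
    rw [hω]; ring
  · filter_upwards [h2] with ω hω
    exact (hμc.intervalIntegrable _ _).add hω

lemma bond_exponent (h : IsModel σ ν ϰ X μ) (hs : 0 ≤ s) (hst : s ≤ t) :
    Measurable[info ν (forwardRate μ X) s] (fun ω => ∫ u in s..t, forwardRate μ X s u ω) ∧
      Pairs ν (fun p => ∫ u in s..t, (Icc 0 s ×ˢ Icc 0 u).indicator ϰ p)
        (fun ω => (∫ u in s..t, forwardRate μ X s u ω) - ∫ u in s..t, μ s u) := by
  obtain ⟨h1, -, h3⟩ := h.integral_path (α := fun _ => s) (β := fun u => max s u)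
    continuous_const (by fun_prop) (fun _ => hs) (fun u => le_max_left _ _) hst (fun _ => le_rfl)
  -- clipping keeps the path in the index set without changing the integrals
  have hclip : ∀ {f : ℝ → ℝ}, ∫ u in s..t, f (max s u) = ∫ u in s..t, f u := by
    intro f
    refine intervalIntegral.integral_congr fun u hu => ?_
    rw [uIcc_of_le hst] at hu
    simp only [max_eq_right hu.1]
  have e1 : ∀ ω, ∫ u in s..t, forwardRate μ X s (max s u) ω =
      ∫ u in s..t, forwardRate μ X s u ω := fun ω => hclip (f := fun u => forwardRate μ X s u ω)
  have e2 : ∀ p, ∫ u in s..t, (Icc 0 s ×ˢ Icc 0 (max s u)).indicator ϰ p =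
      ∫ u in s..t, (Icc 0 s ×ˢ Icc 0 u).indicator ϰ p := fun p =>
    hclip (f := fun u => (Icc 0 s ×ˢ Icc 0 u).indicator ϰ p)
  have e3 : ∫ u in s..t, μ s (max s u) = ∫ u in s..t, μ s u := hclip (f := fun u => μ s u)
  simp only [e1, e2, e3] at h1 h3
  exact ⟨h1, h3⟩

lemma spot_exponent (h : IsModel σ ν ϰ X μ) {a b : ℝ} (ha : 0 ≤ a) (hab : a ≤ b) :
    Measurable[info ν (forwardRate μ X) b]
        (fun ω => ∫ u in a..b, spotRate (forwardRate μ X) u ω) ∧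
      (∀ᵐ ω ∂ν, IntervalIntegrable (fun u => spotRate (forwardRate μ X) u ω) volume a b) ∧
      Pairs ν (fun p => ∫ u in a..b, (Icc 0 u ×ˢ Icc 0 u).indicator ϰ p)
        (fun ω => (∫ u in a..b, spotRate (forwardRate μ X) u ω) - ∫ u in a..b, μ u u) := by
  obtain ⟨h1, h2, h3⟩ := h.integral_path (α := fun u => max a (min u b))
    (β := fun u => max a (min u b)) (s := b)
    (by fun_prop) (by fun_prop) (fun u => ha.trans (le_max_left _ _)) (fun u => le_rfl) hab
    (fun u => max_le hab (min_le_right _ _))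
  have hpt : ∀ u ∈ uIcc a b, max a (min u b) = u := by
    intro u hu
    rw [uIcc_of_le hab] at hu
    rw [min_eq_left hu.2, max_eq_right hu.1]
  have hclip : ∀ {f : ℝ → ℝ}, ∫ u in a..b, f (max a (min u b)) = ∫ u in a..b, f u := by
    intro f
    exact intervalIntegral.integral_congr fun u hu => by simp only [hpt u hu]
  have e1 : ∀ ω, ∫ u in a..b, forwardRate μ X (max a (min u b)) (max a (min u b)) ω =
      ∫ u in a..b, spotRate (forwardRate μ X) u ω := fun ω =>
    hclip (f := fun u => forwardRate μ X u u ω)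
  have e2 : ∀ p, ∫ u in a..b,
      (Icc 0 (max a (min u b)) ×ˢ Icc 0 (max a (min u b))).indicator ϰ p =
      ∫ u in a..b, (Icc 0 u ×ˢ Icc 0 u).indicator ϰ p := fun p =>
    hclip (f := fun u => (Icc 0 u ×ˢ Icc 0 u).indicator ϰ p)
  have e3 : ∫ u in a..b, μ (max a (min u b)) (max a (min u b)) = ∫ u in a..b, μ u u :=
    hclip (f := fun u => μ u u)
  simp only [e1, e2, e3] at h1 h3
  refine ⟨h1, ?_, h3⟩
  filter_upwards [h2] with ω hω
  refine hω.congr fun u hu => ?_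
  simp only [hpt u (uIoc_subset_uIcc hu), spotRate]

lemma pairs_randomExponent (h : IsModel σ ν ϰ X μ) (hs : 0 ≤ s) (hst : s ≤ t) :
    Pairs ν (priceKernel ϰ s t) (randomExponent μ X s t) := by
  refine ((h.bond_exponent hs hst).2.add (h.spot_exponent le_rfl hs).2.2).congr ?_ ?_
  · exact Eventually.of_forall fun p => integral_box_add_integral_box hs hst p
  · refine Eventually.of_forall fun ω => ?_
    simp only [Pi.add_apply, randomExponent, meanExponent]
    ring

lemma measurable_randomExponent (h : IsModel σ ν ϰ X μ) (hs : 0 ≤ s) (hst : s ≤ t) :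
    Measurable[info ν (forwardRate μ X) s] (randomExponent μ X s t) :=
  Measurable.sub_const (Measurable.add (h.bond_exponent hs hst).1 (h.spot_exponent le_rfl hs).1) _

lemma measurable_discountedBondPrice (h : IsModel σ ν ϰ X μ) (hs : 0 ≤ s) (hst : s ≤ t) :
    Measurable[info ν (forwardRate μ X) s] (discountedBondPrice (forwardRate μ X) s t) := by
  have h1 : Measurable[info ν (forwardRate μ X) s] fun ω =>
      Real.exp (-meanExponent μ s t) * Real.exp (-randomExponent μ X s t ω) :=
    Measurable.const_mul (Real.measurable_exp.comp
      (Measurable.neg (h.measurable_randomExponent hs hst))) _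
  rwa [← funext (discountedBondPrice_eq μ X s t)] at h1

lemma integral_discountedBondPrice (h : IsModel σ ν ϰ X μ) (hs : 0 ≤ s) (hst : s ≤ t) :
    Integrable (discountedBondPrice (forwardRate μ X) s t) ν ∧
      ∫ ω, discountedBondPrice (forwardRate μ X) s t ω ∂ν =
        Real.exp (laplaceExponent σ (priceKernel ϰ s t) - meanExponent μ s t) := by
  have := h.isProb
  obtain ⟨h1, h2⟩ := (h.pairs_randomExponent hs hst).integral_exp_neg h.sq_integrable h.isNoise
    (Eventually.of_forall (priceKernel_nonneg h.vol_nonneg s t))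
  have h3 := funext (discountedBondPrice_eq μ X s t)
  constructor
  · rw [h3]; exact h1.const_mul _
  · rw [h3, integral_const_mul, h2, ← Real.exp_add, laplaceExponent]
    congr 1
    ring

lemma integrable_exp_neg_spot (h : IsModel σ ν ϰ X μ) {a b : ℝ} (ha : 0 ≤ a) (hab : a ≤ b) :
    Integrable (fun ω => Real.exp (-∫ u in a..b, spotRate (forwardRate μ X) u ω)) ν := by
  have := h.isProb
  have h1 := ((h.spot_exponent ha hab).2.2.integral_exp_neg h.sq_integrable h.isNoise
    (Eventually.of_forall fun p => ?_)).1
  · refine (h1.const_mul (Real.exp (-∫ u in a..b, μ u u))).congr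
      (Eventually.of_forall fun ω => ?_)
    simp only [← Real.exp_add]
    congr 1
    ring
  · refine intervalIntegral.integral_nonneg hab fun u _ => ?_
    exact indicator_nonneg (fun p hp => h.vol_nonneg p.1 p.2 hp.1.1 hp.2.1) p

/-- The increments of the random exponent do not depend on the past: they evaluate the noise on the
strip `s < x ≤ s'`, while the information up to `s` concerns `x ≤ s`. -/
lemma indep_increment (h : IsModel σ ν ϰ X μ) {s' : ℝ} (hs : 0 ≤ s) (hss' : s ≤ s')
    (hs't : s' ≤ t) :
    Indep (MeasurableSpace.comap
      (fun ω => randomExponent μ X s' t ω - randomExponent μ X s t ω) inferInstance)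
      (info ν (forwardRate μ X) s) ν := by
  have := h.isProb
  have hm : ∀ {r : ℝ}, 0 ≤ r → r ≤ t → Measurable (randomExponent μ X r t) := fun h0 hr =>
    (h.measurable_randomExponent h0 hr).mono (info_le _ _ _) le_rfl
  refine indep_info ?_
  have h1 := indepFun_of_pairs h.sq_integrable h.isNoise
    (ι := {z : ℝ × ℝ // (0 ≤ z.1 ∧ z.1 ≤ s) ∧ z.1 ≤ z.2})
    (f := fun z => (Icc 0 z.1.1 ×ˢ Icc 0 z.1.2).indicator ϰ) (Y := fun z => X z.1.1 z.1.2)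
    (g := priceKernel ϰ s' t - priceKernel ϰ s t)
    (W := randomExponent μ X s' t - randomExponent μ X s t)
    (fun z => h.isField.measurable_eval _ _)
    ((hm (hs.trans hss') hs't).sub (hm hs (hss'.trans hs't)))
    (fun z => (h.isField.isPairing _ _ z.2.1.1 (z.2.1.1.trans z.2.2)).pairs)
    ((h.pairs_randomExponent (hs.trans hss') hs't).sub
      (h.pairs_randomExponent hs (hss'.trans hs't)))
    (fun z => Eventually.of_forall fun p => by
      by_cases hp : p ∈ Icc 0 z.1.1 ×ˢ Icc 0 z.1.2
      · have h2 : p.1 ≤ s := hp.1.2.trans z.2.1.2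
        simp [priceKernel, h2, h2.trans hss']
      · rw [indicator_of_notMem hp, zero_mul])
  rw [IndepFun_iff_Indep] at h1
  refine indep_of_indep_of_le_right h1.symm ?_
  refine iSup₂_le fun u hu => iSup₂_le fun v huv => ?_
  let z : {z : ℝ × ℝ // (0 ≤ z.1 ∧ z.1 ≤ s) ∧ z.1 ≤ z.2} := ⟨(u, v), hu, huv⟩
  have h3 := comap_measurable (m := MeasurableSpace.pi)
    (fun ω (z : {z : ℝ × ℝ // (0 ≤ z.1 ∧ z.1 ≤ s) ∧ z.1 ≤ z.2}) => X z.1.1 z.1.2 ω)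
  exact measurable_iff_comap_le.1 (((measurable_pi_apply z).comp h3).const_add (μ u v))

/-- `Z_{s',t} / Z_{s,t}` is independent of the past, so it has conditional expectation one as soon
as `Z_{s,t}` and `Z_{s',t}` have the same expectation. -/
lemma condExp_discountedBondPrice (h : IsModel σ ν ϰ X μ) {s' : ℝ} (hs : 0 ≤ s)
    (hss' : s ≤ s') (hs't : s' ≤ t)
    (hconst : ∫ ω, discountedBondPrice (forwardRate μ X) s' t ω ∂ν =
      ∫ ω, discountedBondPrice (forwardRate μ X) s t ω ∂ν) :
    ν[discountedBondPrice (forwardRate μ X) s' t | info ν (forwardRate μ X) s] =ᵐ[ν]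
      discountedBondPrice (forwardRate μ X) s t := by
  have := h.isProb
  set Z := discountedBondPrice (forwardRate μ X) s t with hZ
  set Z' := discountedBondPrice (forwardRate μ X) s' t with hZ'
  have hst := hss'.trans hs't
  have hle := info_le ν (forwardRate μ X) s
  let W : Dist → ℝ := fun ω => randomExponent μ X s' t ω - randomExponent μ X s t ω
  let c : ℝ := meanExponent μ s' t - meanExponent μ s t
  let Q : Dist → ℝ := fun ω => Real.exp (-c) * Real.exp (-W ω)
  have hW : Measurable W :=
    ((h.measurable_randomExponent (hs.trans hss') hs't).mono (info_le _ _ _) le_rfl).sub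
      ((h.measurable_randomExponent hs hst).mono (info_le _ _ _) le_rfl)
  have hfac : Z' = Z * Q := by
    ext ω
    simp only [hZ, hZ', Pi.mul_apply, discountedBondPrice_eq, Q, W, c, ← Real.exp_add]
    congr 1
    ring
  have hQm : StronglyMeasurable[MeasurableSpace.comap W inferInstance] Q := by
    refine Measurable.stronglyMeasurable ?_
    exact Measurable.const_mul (Real.measurable_exp.comp (Measurable.neg (comap_measurable W))) _
  have hZm : StronglyMeasurable[info ν (forwardRate μ X) s] Z :=
    Measurable.stronglyMeasurable (h.measurable_discountedBondPrice hs hst)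
  have hind := h.indep_increment hs hss' hs't
  have hZint := (h.integral_discountedBondPrice hs hst).1
  have hZ'int := (h.integral_discountedBondPrice (hs.trans hss') hs't).1
  have hindF : IndepFun Z Q ν := by
    rw [IndepFun_iff_Indep]
    refine indep_of_indep_of_le_left (indep_of_indep_of_le_right hind.symm ?_) ?_
    · exact measurable_iff_comap_le.1 hQm.measurable
    · exact measurable_iff_comap_le.1 hZm.measurable
  have hQm' : Measurable Q := hQm.measurable.mono hW.comap_le le_rfl
  have hZm' : Measurable Z := hZm.measurable.mono hle le_rfl
  have hpos : 0 < ∫ ω, Z ω ∂ν := by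
    rw [hZ, (h.integral_discountedBondPrice hs hst).2]; exact Real.exp_pos _
  have hmul : ∫ ω, Z' ω ∂ν = (∫ ω, Z ω ∂ν) * ∫ ω, Q ω ∂ν := by
    rw [hfac]
    exact hindF.integral_mul_eq_mul_integral hZm'.aestronglyMeasurable hQm'.aestronglyMeasurable
  have hQ1 : ∫ ω, Q ω ∂ν = 1 := by
    rw [hmul] at hconst
    exact mul_left_cancel₀ hpos.ne' (by rw [hconst, mul_one])
  -- a function with a nonzero Bochner integral is integrable
  have hQint : Integrable Q ν := by
    by_contra hn
    rw [integral_undef hn] at hQ1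
    exact zero_ne_one hQ1
  have h1 : ν[Z * Q | info ν (forwardRate μ X) s] =ᵐ[ν] Z * ν[Q | info ν (forwardRate μ X) s] :=
    condExp_mul_of_stronglyMeasurable_left hZm (hfac ▸ hZ'int) hQint
  have h2 := condExp_indep_eq hW.comap_le hle hQm hind
  rw [hfac]
  filter_upwards [h1, h2] with ω hω1 hω2
  rw [hω1, Pi.mul_apply, hω2, hQ1, mul_one]

/-- The discounted price process is a martingale if and only if its expectation is constant. -/
lemma martingale_iff (h : IsModel σ ν ϰ X μ) (ht : 0 ≤ t) :
    Martingale (fun r : Icc (0 : ℝ) t => discountedBondPrice (forwardRate μ X) r t)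
        (infoFiltration ν (forwardRate μ X) t) ν ↔
      ∀ s, 0 ≤ s → s ≤ t → ∫ ω, discountedBondPrice (forwardRate μ X) s t ω ∂ν =
        ∫ ω, discountedBondPrice (forwardRate μ X) 0 t ω ∂ν := by
  have := h.isProb
  constructor
  · intro hm s hs hst
    have h1 := hm.2 (⟨0, le_rfl, ht⟩ : Icc (0 : ℝ) t) ⟨s, hs, hst⟩ hs
    rw [← integral_congr_ae h1]
    exact (integral_condExp (info_le ν (forwardRate μ X) 0)).symm
  · intro hc
    refine ⟨fun r => ?_, fun r r' hrr' => ?_⟩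
    · exact Measurable.stronglyMeasurable (h.measurable_discountedBondPrice r.2.1 r.2.2)
    · exact h.condExp_discountedBondPrice r.2.1 hrr' r'.2.2
        ((hc _ r'.2.1 r'.2.2).trans (hc _ r.2.1 r.2.2).symm)

/-- At maturity the discounted price is the discount factor, which splits at time `s`. -/
lemma discountedBondPrice_self_ae (h : IsModel σ ν ϰ X μ) (hs : 0 ≤ s) (hst : s ≤ t) :
    ∀ᵐ ω ∂ν, discountedBondPrice (forwardRate μ X) t t ω =
      Real.exp (-∫ u in (0 : ℝ)..s, spotRate (forwardRate μ X) u ω) *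
        Real.exp (-∫ u in s..t, spotRate (forwardRate μ X) u ω) := by
  filter_upwards [(h.spot_exponent le_rfl hs).2.1, (h.spot_exponent hs hst).2.1] with ω h1 h2
  rw [discountedBondPrice, bondPrice, intervalIntegral.integral_same,
    ← intervalIntegral.integral_add_adjacent_intervals h1 h2, ← Real.exp_add, ← Real.exp_add]
  congr 1
  ring

/-- Multiplied by the discount factor up to `s`, the pricing formula for `P_{s,t}` is the martingale
property of the discounted price between `s` and maturity. -/
lemma bondPrice_ae_eq_iff (h : IsModel σ ν ϰ X μ) (hs : 0 ≤ s) (hst : s ≤ t) :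
    bondPrice (forwardRate μ X) s t =ᵐ[ν]
        ν[fun ω => Real.exp (-∫ u in s..t, spotRate (forwardRate μ X) u ω) |
          info ν (forwardRate μ X) s] ↔
      ν[discountedBondPrice (forwardRate μ X) t t | info ν (forwardRate μ X) s] =ᵐ[ν]
        discountedBondPrice (forwardRate μ X) s t := by
  have := h.isProb
  let D : Dist → ℝ := fun ω => Real.exp (-∫ u in (0 : ℝ)..s, spotRate (forwardRate μ X) u ω)
  let E : Dist → ℝ := fun ω => Real.exp (-∫ u in s..t, spotRate (forwardRate μ X) u ω)
  have hDm : StronglyMeasurable[info ν (forwardRate μ X) s] D :=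
    Measurable.stronglyMeasurable (Real.measurable_exp.comp
      (Measurable.neg (h.spot_exponent le_rfl hs).1))
  have hDE : discountedBondPrice (forwardRate μ X) t t =ᵐ[ν] D * E :=
    h.discountedBondPrice_self_ae hs hst
  have h1 : ν[discountedBondPrice (forwardRate μ X) t t | info ν (forwardRate μ X) s] =ᵐ[ν]
      D * ν[E | info ν (forwardRate μ X) s] :=
    (condExp_congr_ae hDE).trans (condExp_mul_of_stronglyMeasurable_left hDm
      ((h.integral_discountedBondPrice (hs.trans hst) le_rfl).1.congr hDE)
      (h.integrable_exp_neg_spot hs hst))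
  have hD0 : ∀ ω, D ω ≠ 0 := fun ω => (Real.exp_pos _).ne'
  constructor
  · intro h2
    filter_upwards [h1, h2] with ω hω1 hω2
    rw [hω1, Pi.mul_apply, ← hω2, mul_comm]
    rfl
  · intro h2
    filter_upwards [h1, h2] with ω hω1 hω2
    rw [hω1, Pi.mul_apply, mul_comm] at hω2
    exact (mul_right_cancel₀ (hD0 ω) hω2).symm

end IsModel

/-! ### The drift condition -/

/-- The drift correction `∫_0^t ∫_0^s ∫ τ ϰ (1 - e^{-τ ϰ (t - x ∨ y)}) σ(dτ) dx dy`. -/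
def driftCorrection (σ : Measure ℝ) (ϰ : ℝ × ℝ → ℝ) (s t : ℝ) : ℝ :=
  ∫ y in (0 : ℝ)..t, ∫ x in (0 : ℝ)..s, ∫ τ in Ioi (0 : ℝ),
    τ * ϰ (x, y) * (1 - Real.exp (-(τ * ϰ (x, y) * (t - max x y)))) ∂σ

/-- The integrand of the drift correction, extended by zero to all positions and jump sizes. -/
def driftDensity (ϰ : ℝ × ℝ → ℝ) (s v : ℝ) (q : (ℝ × ℝ) × ℝ) : ℝ :=
  if 0 ≤ q.1.1 ∧ q.1.1 ≤ s ∧ 0 ≤ q.1.2 then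
    q.2 * ϰ q.1 * (1 - Real.exp (-(q.2 * ϰ q.1 * max (v - max q.1.1 q.1.2) 0))) else 0

/-- `e^{-az} - 1 + az`, `z = (t - m)⁺`, has the time derivative `a (1 - e^{-az})`. -/
lemma integral_one_sub_exp (a : ℝ) {m t : ℝ} (hm : 0 ≤ m) (ht : 0 ≤ t) :
    ∫ v in (0 : ℝ)..t, a * (1 - Real.exp (-(a * max (v - m) 0))) =
      Real.exp (-(a * max (t - m) 0)) - 1 + a * max (t - m) 0 := by
  have hcont : Continuous fun v : ℝ => a * (1 - Real.exp (-(a * max (v - m) 0))) := by fun_prop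
  have hzero : ∀ r, 0 ≤ r → r ≤ m →
      ∫ v in (0 : ℝ)..r, a * (1 - Real.exp (-(a * max (v - m) 0))) = 0 := by
    intro r hr hrm
    rw [intervalIntegral.integral_congr (g := fun _ => (0 : ℝ))]
    · simp
    · intro v hv
      rw [uIcc_of_le hr] at hv
      simp [max_eq_right (by linarith [hv.2] : v - m ≤ 0)]
  rcases le_total t m with h | h
  · rw [hzero t ht h, max_eq_right (by linarith : t - m ≤ 0)]
    simp
  · rw [← intervalIntegral.integral_add_adjacent_intervals (hcont.intervalIntegrable 0 m)
      (hcont.intervalIntegrable m t), hzero m hm le_rfl, zero_add,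
      max_eq_left (by linarith : 0 ≤ t - m)]
    have h1 : ∫ v in m..t, a * (1 - Real.exp (-(a * max (v - m) 0))) =
        ∫ v in m..t, a * (1 - Real.exp (-(a * (v - m)))) := by
      refine intervalIntegral.integral_congr fun v hv => ?_
      rw [uIcc_of_le h] at hv
      simp only [max_eq_left (by linarith [hv.1] : 0 ≤ v - m)]
    have h2 : ∀ v ∈ uIcc m t, HasDerivAt (fun v => Real.exp (-(a * (v - m))) + a * (v - m))
        (a * (1 - Real.exp (-(a * (v - m))))) v := by
      intro v _
      have h3 : HasDerivAt (fun v : ℝ => a * (v - m)) a v := by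
        simpa using ((hasDerivAt_id v).sub_const m).const_mul a
      exact (h3.fun_neg.exp.add h3).congr_deriv (by ring)
    rw [h1, intervalIntegral.integral_eq_sub_of_hasDerivAt h2
      (Continuous.intervalIntegrable (by fun_prop) _ _)]
    simp
    ring

lemma integral_driftDensity (ϰ : ℝ × ℝ → ℝ) (s : ℝ) {t : ℝ} (ht : 0 ≤ t) (q : (ℝ × ℝ) × ℝ) :
    ∫ v in (0 : ℝ)..t, driftDensity ϰ s v q =
      Real.exp (-jumpOf (priceKernel ϰ s t) q) - 1 + jumpOf (priceKernel ϰ s t) q := by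
  by_cases hq : 0 ≤ q.1.1 ∧ q.1.1 ≤ s ∧ 0 ≤ q.1.2
  · simp only [driftDensity, jumpOf, priceKernel, if_pos hq, ← mul_assoc]
    exact integral_one_sub_exp _ (hq.1.trans (le_max_left _ _)) ht
  · simp [driftDensity, jumpOf, priceKernel, hq]

lemma measurable_driftDensity {ϰ : ℝ × ℝ → ℝ} (hϰ : Measurable ϰ) (s : ℝ) :
    Measurable (Function.uncurry (driftDensity ϰ s)) := by
  have hS : MeasurableSet {z : ℝ × ((ℝ × ℝ) × ℝ) | 0 ≤ z.2.1.1 ∧ z.2.1.1 ≤ s ∧ 0 ≤ z.2.1.2} :=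
    (measurableSet_le measurable_const measurable_snd.fst.fst).inter
      ((measurableSet_le measurable_snd.fst.fst measurable_const).inter
        (measurableSet_le measurable_const measurable_snd.fst.snd))
  have hk : Measurable fun z : ℝ × ((ℝ × ℝ) × ℝ) => ϰ z.2.1 := hϰ.comp measurable_snd.fst
  exact Measurable.ite hS (by fun_prop) measurable_const

namespace IsModel

variable {σ : Measure ℝ} {ν : Measure Dist} {ϰ : ℝ × ℝ → ℝ} {X : ℝ → ℝ → Dist → ℝ}
  {μ : ℝ → ℝ → ℝ} {s t : ℝ}

/-- On bounded time sets the density of the drift correction has an integrable majorant. -/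
lemma exists_bound_driftDensity (h : IsModel σ ν ϰ X μ) (s T : ℝ) :
    ∃ g : (ℝ × ℝ) × ℝ → ℝ, Integrable g (jumpMeasure σ) ∧
      ∀ᵐ q ∂jumpMeasure σ, ∀ v, v ≤ T → ‖driftDensity ϰ s v q‖ ≤ g q := by
  have := sigmaFinite_restrict_Ioi h.sq_integrable
  obtain ⟨C, hC⟩ := h.vol_bdd T
  refine ⟨fun q => (Icc 0 T ×ˢ Icc 0 T).indicator (fun _ => C ^ 2 * T) q.1 * q.2 ^ 2, ?_, ?_⟩
  · refine Integrable.mul_prod (μ := (volume : Measure (ℝ × ℝ))) (ν := σ.restrict (Ioi 0))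
      (f := (Icc 0 T ×ˢ Icc 0 T).indicator fun _ => C ^ 2 * T) (g := fun τ => τ ^ 2) ?_
      h.sq_integrable
    refine (integrable_indicator_iff (measurableSet_Icc.prod measurableSet_Icc)).2
      (integrableOn_const ?_)
    exact (isCompact_Icc.prod isCompact_Icc).measure_lt_top.ne
  · filter_upwards [ae_jumpMeasure_pos h.sq_integrable] with q hq v hv
    obtain ⟨⟨x, y⟩, τ⟩ := q
    simp only at hq
    by_cases hxy : (0 ≤ x ∧ x ≤ s ∧ 0 ≤ y) ∧ max x y < v
    · obtain ⟨hc, hm⟩ := hxy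
      have hmem : (x, y) ∈ Icc 0 T ×ˢ Icc 0 T :=
        ⟨⟨hc.1, ((le_max_left x y).trans_lt hm).le.trans hv⟩,
          ⟨hc.2.2, ((le_max_right x y).trans_lt hm).le.trans hv⟩⟩
      have hm0 : 0 ≤ max x y := hc.1.trans (le_max_left _ _)
      have hk0 := h.vol_nonneg x y hc.1 hc.2.2
      have hkC : ϰ (x, y) ≤ C := hC ⟨_, hmem, rfl⟩
      have hz : 0 ≤ τ * ϰ (x, y) * (v - max x y) :=
        mul_nonneg (mul_nonneg hq.le hk0) (by linarith)
      have h1 : 0 ≤ 1 - Real.exp (-(τ * ϰ (x, y) * (v - max x y))) := by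
        have := Real.exp_le_one_iff.2 (neg_nonpos.2 hz)
        linarith
      have h2 : 1 - Real.exp (-(τ * ϰ (x, y) * (v - max x y))) ≤
          τ * ϰ (x, y) * (v - max x y) := by
        have := Real.add_one_le_exp (-(τ * ϰ (x, y) * (v - max x y)))
        linarith
      simp only [driftDensity, if_pos hc, indicator_of_mem hmem,
        max_eq_left (by linarith : 0 ≤ v - max x y)]
      rw [Real.norm_eq_abs, abs_of_nonneg (mul_nonneg (mul_nonneg hq.le hk0) h1)]
      calc τ * ϰ (x, y) * (1 - Real.exp (-(τ * ϰ (x, y) * (v - max x y))))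
          ≤ τ * ϰ (x, y) * (τ * ϰ (x, y) * (v - max x y)) := by gcongr
        _ = ϰ (x, y) ^ 2 * (v - max x y) * τ ^ 2 := by ring
        _ ≤ C ^ 2 * T * τ ^ 2 := by
            gcongr
            linarith
    · have h0 : driftDensity ϰ s v ((x, y), τ) = 0 := by
        by_cases hc : 0 ≤ x ∧ x ≤ s ∧ 0 ≤ y
        · have hm : v ≤ max x y := not_lt.1 fun hm => hxy ⟨hc, hm⟩
          simp [driftDensity, max_eq_right (by linarith : v - max x y ≤ 0)]
        · simp [driftDensity, hc]
      rw [h0, norm_zero]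
      refine mul_nonneg ?_ (sq_nonneg _)
      refine indicator_nonneg (fun p hp => mul_nonneg (sq_nonneg _) ?_) _
      exact hp.1.1.trans hp.1.2

lemma integrable_driftDensity (h : IsModel σ ν ϰ X μ) (s v : ℝ) :
    Integrable (driftDensity ϰ s v) (jumpMeasure σ) := by
  obtain ⟨g, hg, hb⟩ := h.exists_bound_driftDensity s v
  refine hg.mono' ?_ (hb.mono fun q hq => hq v le_rfl)
  exact ((measurable_driftDensity h.measurable_vol s).comp
    measurable_prodMk_left).aestronglyMeasurable

lemma continuous_integral_driftDensity (h : IsModel σ ν ϰ X μ) (s : ℝ) :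
    Continuous fun v => ∫ q, driftDensity ϰ s v q ∂jumpMeasure σ := by
  refine continuous_iff_continuousAt.2 fun v₀ => ?_
  obtain ⟨g, hg, hb⟩ := h.exists_bound_driftDensity s (v₀ + 1)
  refine tendsto_integral_filter_of_dominated_convergence g ?_ ?_ hg ?_
  · exact Eventually.of_forall fun v => (h.integrable_driftDensity s v).1
  · filter_upwards [gt_mem_nhds (lt_add_one v₀)] with v hv
    filter_upwards [hb] with q hq using hq v hv.le
  · refine Eventually.of_forall fun q => ?_
    have : Continuous fun v => driftDensity ϰ s v q := by
      unfold driftDensity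
      split_ifs <;> fun_prop
    exact this.tendsto v₀

/-- The Laplace exponent of the log-price accumulates the drift corrections. -/
lemma laplaceExponent_priceKernel (h : IsModel σ ν ϰ X μ) (s : ℝ) (ht : 0 ≤ t) :
    laplaceExponent σ (priceKernel ϰ s t) =
      ∫ v in (0 : ℝ)..t, ∫ q, driftDensity ϰ s v q ∂jumpMeasure σ := by
  have := sigmaFinite_restrict_Ioi h.sq_integrable
  have hsf : SFinite (jumpMeasure σ) := by unfold jumpMeasure; infer_instance
  obtain ⟨g, hg, hb⟩ := h.exists_bound_driftDensity s t
  have hint : Integrable (Function.uncurry (driftDensity ϰ s))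
      ((volume.restrict (Ioc 0 t)).prod (jumpMeasure σ)) := by
    refine Integrable.mono' (hg.comp_snd (volume.restrict (Ioc 0 t)))
      (measurable_driftDensity h.measurable_vol s).aestronglyMeasurable ?_
    have h1 := (Measure.quasiMeasurePreserving_fst (μ := volume.restrict (Ioc 0 t))
      (ν := jumpMeasure σ)).ae (ae_restrict_mem measurableSet_Ioc)
    have h2 := (Measure.quasiMeasurePreserving_snd (μ := volume.restrict (Ioc 0 t))
      (ν := jumpMeasure σ)).ae hb
    filter_upwards [h1, h2] with z hz1 hz2 using hz2 z.1 hz1.2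
  rw [intervalIntegral.integral_of_le ht, integral_integral_swap hint, laplaceExponent]
  congr 1
  ext q
  rw [← integral_driftDensity ϰ s ht q, intervalIntegral.integral_of_le ht]

lemma integral_driftDensity_eq (h : IsModel σ ν ϰ X μ) (hs : 0 ≤ s) (hst : s ≤ t) :
    ∫ q, driftDensity ϰ s t q ∂jumpMeasure σ = driftCorrection σ ϰ s t := by
  have := sigmaFinite_restrict_Ioi h.sq_integrable
  have hint := h.integrable_driftDensity s t
  rw [jumpMeasure] at hint
  set k : ℝ × ℝ → ℝ := fun p => ∫ τ in Ioi (0 : ℝ), driftDensity ϰ s t (p, τ) ∂σ with hk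
  have hkint : Integrable k := hint.integral_prod_left
  have hk0 : ∀ p, p ∉ Icc 0 s ×ˢ Icc 0 t → k p = 0 := by
    intro p hp
    rw [hk]
    refine integral_eq_zero_of_ae (Eventually.of_forall fun τ => ?_)
    by_cases hc : 0 ≤ p.1 ∧ p.1 ≤ s ∧ 0 ≤ p.2
    · have h1 : t ≤ p.2 := le_of_not_gt fun h2 => hp ⟨⟨hc.1, hc.2.1⟩, ⟨hc.2.2, h2.le⟩⟩
      have h2 : t - max p.1 p.2 ≤ 0 := by linarith [le_max_right p.1 p.2]
      simp [driftDensity, max_eq_right h2]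
    · simp [driftDensity, hc]
  have hae : (Icc 0 s ×ˢ Icc 0 t : Set (ℝ × ℝ)) =ᵐ[volume] Ioc 0 s ×ˢ Ioc 0 t :=
    Measure.set_prod_ae_eq Ioc_ae_eq_Icc.symm Ioc_ae_eq_Icc.symm
  have hrest : (volume : Measure (ℝ × ℝ)).restrict (Ioc 0 s ×ˢ Ioc 0 t) =
      (volume.restrict (Ioc 0 s)).prod (volume.restrict (Ioc 0 t)) := by
    rw [Measure.prod_restrict]; rfl
  have hkint' : Integrable k ((volume.restrict (Ioc 0 s)).prod (volume.restrict (Ioc 0 t))) := by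
    rw [← hrest]; exact hkint.restrict
  rw [jumpMeasure, integral_prod _ hint]
  change ∫ p, k p = _
  rw [← setIntegral_eq_integral_of_forall_compl_eq_zero hk0, setIntegral_congr_set hae, hrest,
    integral_prod_symm _ hkint', driftCorrection, intervalIntegral.integral_of_le (hs.trans hst)]
  refine setIntegral_congr_fun measurableSet_Ioc fun y hy => ?_
  simp only [intervalIntegral.integral_of_le hs]
  refine setIntegral_congr_fun measurableSet_Ioc fun x hx => ?_
  simp only [hk]
  congr 1
  ext τ
  have h1 : 0 ≤ t - max x y := sub_nonneg.2 (max_le (hx.2.trans hst) hy.2)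
  simp [driftDensity, hx.1.le, hx.2, hy.1.le, max_eq_left h1]

/-- Positions with `x > v` do not matter at time `v`. -/
lemma integral_driftDensity_eq_diag (h : IsModel σ ν ϰ X μ) {v : ℝ} (hv : 0 ≤ v) (hvs : v ≤ s) :
    ∫ q, driftDensity ϰ s v q ∂jumpMeasure σ = driftCorrection σ ϰ v v := by
  rw [← h.integral_driftDensity_eq hv le_rfl]
  congr 1
  ext q
  by_cases hq : q.1.1 ≤ v
  · simp [driftDensity, hq, hq.trans hvs]
  · have h1 : v - max q.1.1 q.1.2 ≤ 0 := by linarith [le_max_left q.1.1 q.1.2, not_le.1 hq]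
    simp [driftDensity, max_eq_right h1]

lemma meanExponent_sub (h : IsModel σ ν ϰ X μ) (hs : 0 ≤ s) (hst : s ≤ t) :
    meanExponent μ s t - meanExponent μ 0 t =
      (∫ u in s..t, (μ s u - μ 0 u)) + ∫ u in (0 : ℝ)..s, (μ u u - μ 0 u) := by
  have hII : ∀ {α : ℝ → ℝ} {a b : ℝ}, a ≤ b → ContinuousOn α (Icc a b) → (∀ u ∈ Icc a b, 0 ≤ α u) →
      (∀ u ∈ Icc a b, α u ≤ u) → IntervalIntegrable (fun u => μ (α u) u) volume a b := by
    intro α a b hab hα h0 hle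
    refine ContinuousOn.intervalIntegrable ?_
    rw [uIcc_of_le hab]
    exact h.continuousOn_mean.comp (hα.prodMk continuousOn_id) fun u hu => ⟨h0 u hu, hle u hu⟩
  have i1 := hII (α := fun _ => s) hst continuousOn_const (fun _ _ => hs) (fun u hu => hu.1)
  have i2 := hII (α := fun _ => 0) hst continuousOn_const (fun _ _ => le_rfl)
    (fun u hu => hs.trans hu.1)
  have i3 := hII (α := fun u => u) hs continuousOn_id (fun u hu => hu.1) (fun u _ => le_rfl)
  have i4 := hII (α := fun _ => 0) hs continuousOn_const (fun _ _ => le_rfl) (fun u hu => hu.1)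
  rw [intervalIntegral.integral_sub i1 i2, intervalIntegral.integral_sub i3 i4, meanExponent,
    meanExponent, intervalIntegral.integral_same, add_zero,
    ← intervalIntegral.integral_add_adjacent_intervals i4 i2]
  ring

lemma laplaceExponent_eq_add (h : IsModel σ ν ϰ X μ) (hs : 0 ≤ s) (hst : s ≤ t) :
    laplaceExponent σ (priceKernel ϰ s t) =
      (∫ u in s..t, driftCorrection σ ϰ s u) + ∫ u in (0 : ℝ)..s, driftCorrection σ ϰ u u := by
  have hc := h.continuous_integral_driftDensity s
  rw [h.laplaceExponent_priceKernel s (hs.trans hst),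
    ← intervalIntegral.integral_add_adjacent_intervals (hc.intervalIntegrable 0 s)
      (hc.intervalIntegrable s t), add_comm]
  congr 1
  · refine intervalIntegral.integral_congr fun u hu => ?_
    rw [uIcc_of_le hst] at hu
    exact h.integral_driftDensity_eq hs hu.1
  · refine intervalIntegral.integral_congr fun u hu => ?_
    rw [uIcc_of_le hs] at hu
    exact h.integral_driftDensity_eq_diag hu.1 hu.2

lemma laplaceExponent_zero (h : IsModel σ ν ϰ X μ) (ht : 0 ≤ t) :
    laplaceExponent σ (priceKernel ϰ 0 t) = 0 := by
  rw [h.laplaceExponent_eq_add le_rfl ht]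
  simp [driftCorrection]

/-- Integrated in time, the drift condition says that the expected discounted prices do not depend
on `s`. -/
lemma drift_condition_iff (h : IsModel σ ν ϰ X μ) :
    (∀ s t, 0 ≤ s → s ≤ t → μ s t = μ 0 t + driftCorrection σ ϰ s t) ↔
      ∀ s t, 0 ≤ s → s ≤ t → meanExponent μ s t - meanExponent μ 0 t =
        laplaceExponent σ (priceKernel ϰ s t) := by
  constructor
  · intro hb s t hs hst
    rw [h.meanExponent_sub hs hst, h.laplaceExponent_eq_add hs hst]
    congr 1
    · refine intervalIntegral.integral_congr fun u hu => ?_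
      rw [uIcc_of_le hst] at hu
      simp only [hb s u hs hu.1, add_sub_cancel_left]
    · refine intervalIntegral.integral_congr fun u hu => ?_
      rw [uIcc_of_le hs] at hu
      simp only [hb u u hu.1 le_rfl, add_sub_cancel_left]
  · intro hE s t hs hst
    have hdiff : ∀ r, s ≤ r → ∫ u in s..r, (μ s u - μ 0 u) =
        ∫ u in s..r, driftCorrection σ ϰ s u := by
      intro r hr
      have h1 := hE s r hs hr
      have h2 := hE s s hs le_rfl
      rw [h.meanExponent_sub hs hr, h.laplaceExponent_eq_add hs hr] at h1
      rw [h.meanExponent_sub hs le_rfl, h.laplaceExponent_eq_add hs le_rfl,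
        intervalIntegral.integral_same, intervalIntegral.integral_same, zero_add, zero_add] at h2
      linarith
    -- continuous versions of both integrands, defined on the whole line
    let k : ℝ → ℝ := fun u =>
      μ s (max s u) - μ 0 (max s u) - ∫ q, driftDensity ϰ s u q ∂jumpMeasure σ
    have hμ1 : Continuous fun u => μ s (max s u) :=
      h.continuous_mean_clip (α := fun _ => s) (β := fun u => max s u) continuous_const
        (by fun_prop) (fun _ => hs) (fun u => le_max_left _ _)
    have hμ0 : Continuous fun u => μ 0 (max s u) :=
      h.continuous_mean_clip (α := fun _ => 0) (β := fun u => max s u) continuous_const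
        (by fun_prop) (fun _ => le_rfl) (fun u => hs.trans (le_max_left _ _))
    have hβ := h.continuous_integral_driftDensity s
    have hk : Continuous k := (hμ1.sub hμ0).sub hβ
    have hkz : ∀ r, s ≤ r → ∫ u in s..r, k u = 0 := by
      intro r hr
      have e1 : ∫ u in s..r, (μ s (max s u) - μ 0 (max s u)) = ∫ u in s..r, (μ s u - μ 0 u) := by
        refine intervalIntegral.integral_congr fun u hu => ?_
        rw [uIcc_of_le hr] at hu
        simp only [max_eq_right hu.1]
      have e2 : ∫ u in s..r, ∫ q, driftDensity ϰ s u q ∂jumpMeasure σ =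
          ∫ u in s..r, driftCorrection σ ϰ s u := by
        refine intervalIntegral.integral_congr fun u hu => ?_
        rw [uIcc_of_le hr] at hu
        exact h.integral_driftDensity_eq hs hu.1
      have e3 := intervalIntegral.integral_sub
        ((hμ1.fun_sub hμ0).intervalIntegrable (μ := volume) s r) (hβ.intervalIntegrable s r)
      rw [e1, e2, hdiff r hr, sub_self] at e3
      exact e3
    have hd1 : HasDerivWithinAt (fun r => ∫ u in s..r, k u) (k t) (Ici t) t :=
      (hk.integral_hasStrictDerivAt s t).hasDerivAt.hasDerivWithinAt
    have hd2 : HasDerivWithinAt (fun r => ∫ u in s..r, k u) 0 (Ici t) t :=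
      (hasDerivWithinAt_const t (Ici t) (0 : ℝ)).congr (fun r hr => hkz r (hst.trans hr))
        (hkz t hst)
    have hkt : k t = 0 := (uniqueDiffWithinAt_Ici t).eq_deriv _ hd1 hd2
    simp only [k, max_eq_right hst] at hkt
    rw [h.integral_driftDensity_eq hs hst] at hkt
    linarith

end IsModel

end LevyTermStructure

end

theorem theorem2p1
    (σ : Measure ℝ) (hσ : IntegrableOn (fun τ : ℝ => τ ^ 2) (Ioi 0) σ)
    (ν : Measure LevyTermStructure.Dist) [IsProbabilityMeasure ν]
    (hν : LevyTermStructure.IsCenteredLevyNoise σ ν)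
    (ϰ : ℝ × ℝ → ℝ) (hϰ_meas : Measurable ϰ)
    (hϰ_nonneg : ∀ x y : ℝ, 0 ≤ x → 0 ≤ y → 0 ≤ ϰ (x, y))
    (hϰ_bdd : ∀ T : ℝ, BddAbove (ϰ '' (Icc 0 T ×ˢ Icc 0 T)))
    (X : ℝ → ℝ → LevyTermStructure.Dist → ℝ) (hX : LevyTermStructure.IsLevyField ν ϰ X)
    (μ : ℝ → ℝ → ℝ)
    (hμ : ContinuousOn (fun p : ℝ × ℝ => μ p.1 p.2) {p | 0 ≤ p.1 ∧ p.1 ≤ p.2})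
    (F : ℝ → ℝ → LevyTermStructure.Dist → ℝ) (hF : F = LevyTermStructure.forwardRate μ X) :
    List.TFAE [
      ∀ t : ℝ, 0 ≤ t →
        Martingale (fun (s : Icc (0 : ℝ) t) => LevyTermStructure.discountedBondPrice F s t)
          (LevyTermStructure.infoFiltration ν F t) ν,
      ∀ s t : ℝ, 0 ≤ s → s ≤ t →
        μ s t = μ 0 t + ∫ y in (0 : ℝ)..t, ∫ x in (0 : ℝ)..s, ∫ τ in Ioi (0 : ℝ),
          τ * ϰ (x, y) * (1 - Real.exp (-(τ * ϰ (x, y) * (t - max x y)))) ∂σ,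
      ∀ s t : ℝ, 0 ≤ s → s ≤ t →
        LevyTermStructure.bondPrice F s t =ᵐ[ν]
          ν[fun ω => Real.exp (-∫ u in s..t, LevyTermStructure.spotRate F u ω) |
            LevyTermStructure.info ν F s]] := by
  have hp : LevyTermStructure.IsModel σ ν ϰ X μ :=
    ⟨inferInstance, hσ, hν, hϰ_meas, hϰ_nonneg, hϰ_bdd, hX, hμ⟩
  subst hF
  have h12 : (∀ t : ℝ, 0 ≤ t →
      Martingale (fun (s : Icc (0 : ℝ) t) => LevyTermStructure.discountedBondPrice
        (LevyTermStructure.forwardRate μ X) s t)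
        (LevyTermStructure.infoFiltration ν (LevyTermStructure.forwardRate μ X) t) ν) ↔
      ∀ s t : ℝ, 0 ≤ s → s ≤ t → μ s t = μ 0 t + LevyTermStructure.driftCorrection σ ϰ s t := by
    rw [hp.drift_condition_iff]
    have key : ∀ s t : ℝ, 0 ≤ s → s ≤ t →
        (∫ ω, LevyTermStructure.discountedBondPrice (LevyTermStructure.forwardRate μ X) s t ω ∂ν =
          ∫ ω, LevyTermStructure.discountedBondPrice (LevyTermStructure.forwardRate μ X) 0 t ω ∂ν ↔
        LevyTermStructure.meanExponent μ s t - LevyTermStructure.meanExponent μ 0 t =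
          LevyTermStructure.laplaceExponent σ (LevyTermStructure.priceKernel ϰ s t)) := by
      intro s t hs hst
      rw [(hp.integral_discountedBondPrice hs hst).2,
        (hp.integral_discountedBondPrice le_rfl (hs.trans hst)).2, Real.exp_eq_exp,
        hp.laplaceExponent_zero (hs.trans hst)]
      constructor <;> intro h <;> linarith
    constructor
    · intro hm s t hs hst
      exact (key s t hs hst).1
        ((hp.martingale_iff (hs.trans hst)).1 (hm t (hs.trans hst)) s hs hst)
    · intro hE t ht
      exact (hp.martingale_iff ht).2 fun s hs hst => (key s t hs hst).2 (hE s t hs hst)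
  tfae_have 1 ↔ 2 := h12
  tfae_have 1 → 3 := by
    intro hm s t hs hst
    exact (hp.bondPrice_ae_eq_iff hs hst).2 ((hm t (hs.trans hst)).2
      (⟨s, hs, hst⟩ : Icc (0 : ℝ) t) ⟨t, hs.trans hst, le_rfl⟩ hst)
  tfae_have 3 → 1 := by
    intro hc t ht
    -- the expectations agree with the one at maturity, and constancy in `s` is all that is needed
    refine (hp.martingale_iff ht).2 fun s hs hst => ?_
    have h1 : ∀ r, 0 ≤ r → r ≤ t →
        ∫ ω, LevyTermStructure.discountedBondPrice (LevyTermStructure.forwardRate μ X) r t ω ∂ν =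
        ∫ ω, LevyTermStructure.discountedBondPrice (LevyTermStructure.forwardRate μ X) t t ω ∂ν :=
      fun r hr hrt => by
        rw [← integral_congr_ae ((hp.bondPrice_ae_eq_iff hr hrt).1 (hc r t hr hrt))]
        exact integral_condExp (LevyTermStructure.info_le ν _ r)
    rw [h1 s hs hst, h1 0 le_rfl ht]
  tfae_finish
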